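/- **Definitions.** Write $T=(\mathbb C^*)^n$, $n\ge 0$. A *smooth character* is a smooth homomorphism $\chi:T\to\mathbb C^*$, and $V(\chi)$ is $\mathbb C$ with $T$ acting through $\chi$. If $T$ acts on a $2n$-dimensional smooth manifold $X$, an *equivariant chart* is an equivariant diffeomorphism $\varphi=(\varphi_1,\dots,\varphi_n)$ from a $T$-invariant open subset of $X$ onto $V(\chi_1)\oplus\dots\oplus V(\chi_n)=\mathbb C^n$ for some smooth characters $\chi_1,\dots,\chi_n$. A *topological toric manifold* of dimension $2n$ is a closed smooth $2n$-manifold with an effective smooth action of $T$ which has an open dense orbit and is covered by the domains of equivariant charts. If $J$ is an almost complex structure on $X$, an equivariant chart $\varphi$ is *compatible with $J$* if for all $i$ it carries the orientation of the normal bundle of $\{\varphi_i=0\}$ determined by $J$ to the standard one, i.e. $(d\varphi_i(\xi),d\varphi_i(J\xi))$ is a positively oriented real basis of $\mathbb C$ for every tangent vector $\xi$ at a point of $\{\varphi_i=0\}$ with $d\varphi_i(\xi)\ne 0$. A *toric manifold* is a nonsingular complete toric variety over $\mathbb C$, i.e. the toric variety of a nonsingular complete fan in $\mathbb R^n$ (with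 lattice $\mathbb Z^n$), with its complex manifold structure and its action of $(\mathbb C^*)^n$. **Theorem.** Let $X$ be a topological toric manifold of dimension $2n$ and let $J$ be a $(\mathbb C^*)^n$-invariant smooth almost complex structure on $X$. Then: 1. $J$ is integrable, i.e. around every point of $X$ there is a smooth chart with values in $\mathbb C^n$ that is holomorphic with respect to $J$. 2. Every equivariant chart of $X$ that is compatible with $J$ is holomorphic with respect to $J$; and every equivariant chart of $X$ becomes compatible with $J$ after complex conjugation of some of its coordinates $\varphi_i$. 3. $X$ is weakly equivariantly isomorphic to a toric manifold: there are a toric manifold $Y$ of complex dimension $n$, a biholomorphism $f:(X,J)\to Y$ and a smooth automorphism $\rho$ of $(\mathbb C^*)^n$ such that $f(g\cdot x)=\rho(g)\cdot f(x)$ for all $g\in(\mathbb C^*)^n$ and $x\in X$. -/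

import Mathlib

open scoped Manifold ContDiff

noncomputable section

/-! ### The algebraic torus -/

/-- The torus `(ℂ^*)^k`, as the group of invertible elements of the product algebra `ℂ^k`.
With this description Mathlib provides its structure of a Lie group modelled on `ℂ^k`. -/
abbrev CTorus (k : ℕ) : Type := (Fin k → ℂ)ˣ

namespace CTorus

/-- The `i`-th coordinate `(ℂ^*)^k → ℂ^*`. -/
def coord {k : ℕ} (i : Fin k) : CTorus k →* ℂˣ := Units.map (Pi.evalMonoidHom (fun _ => ℂ) i)

/-- The element of `(ℂ^*)^k` with the given coordinates. -/
def ofCoords {k : ℕ} (c : Fin k → ℂˣ) : CTorus k := MulEquiv.piUnits.symm c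

theorem coord_ofCoords {k : ℕ} (c : Fin k → ℂˣ) (i : Fin k) : coord i (ofCoords c) = c i := by
  ext; rfl

theorem coe_coord {k : ℕ} (h : CTorus k) (i : Fin k) :
    ((coord i h : ℂˣ) : ℂ) = (h : Fin k → ℂ) i := rfl

theorem ext_coord {k : ℕ} {g h : CTorus k} (H : ∀ i, coord i g = coord i h) : g = h := by
  apply Units.ext
  funext i
  exact congrArg Units.val (H i)

end CTorus

/-! ### Nonsingular complete fans and their toric varieties -/

/-- The cone in `ℝ^n` spanned by the integral vectors `ray i`, `i ∈ I`. -/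
def rayCone {n m : ℕ} (ray : Fin m → Fin n → ℤ) (I : Finset (Fin m)) : Set (Fin n → ℝ) :=
  {x | ∃ a : Fin m → ℝ, (∀ i, 0 ≤ a i) ∧ ∀ j, x j = ∑ i ∈ I, a i * (ray i j : ℝ)}

/-- A nonsingular complete fan in `ℤ^n ⊆ ℝ^n`: an abstract simplicial complex on `m` vertices, and
for each vertex an integral vector (the primitive generator of a ray), such that the cones spanned
by the simplices form a complete fan all of whose cones are nonsingular. -/
structure NonsingularCompleteFan (n : ℕ) where
  /-- the number of rays -/
  m : ℕ
  /-- the simplicial complex -/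
  simplices : Set (Finset (Fin m))
  /-- the generators of the rays -/
  ray : Fin m → Fin n → ℤ
  empty_mem : ∅ ∈ simplices
  vertex_mem : ∀ i, {i} ∈ simplices
  down_closed : ∀ I ∈ simplices, ∀ K, K ⊆ I → K ∈ simplices
  /-- the generators of each cone are part of a basis of the lattice `ℤ^n` -/
  nonsingular : ∀ I ∈ simplices, ∃ (b : Module.Basis (Fin n) ℤ (Fin n → ℤ)) (e : I ↪ Fin n),
    ∀ i : I, b (e i) = ray i
  /-- any two cones meet in their common face -/
  inter : ∀ I ∈ simplices, ∀ K ∈ simplices, rayCone ray I ∩ rayCone ray K = rayCone ray (I ∩ K)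
  /-- the cones cover `ℝ^n` -/
  complete : ∀ x : Fin n → ℝ, ∃ I ∈ simplices, x ∈ rayCone ray I

namespace NonsingularCompleteFan

section linear_algebra

theorem prod_zpow_exp {G ι : Type*} [CommGroup G] (s : Finset ι) (a : G) (f : ι → ℤ) :
    ∏ i ∈ s, a ^ f i = a ^ ∑ i ∈ s, f i := by
  classical
  induction s using Finset.induction_on with
  | empty => simp
  | insert i s hi ih => rw [Finset.prod_insert hi, Finset.sum_insert hi, ih, zpow_add]

variable {n : ℕ} (b : Module.Basis (Fin n) ℤ (Fin n → ℤ))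

/-- The real extension of a coordinate functional of a basis of `ℤ^n`. -/
def coordR (k : Fin n) : (Fin n → ℝ) →ₗ[ℝ] ℝ :=
  ∑ j, ((b.coord k (Pi.single j 1) : ℤ) : ℝ) • LinearMap.proj j

theorem coord_eq_sum (k : Fin n) (u : Fin n → ℤ) :
    b.coord k u = ∑ j, b.coord k (Pi.single j 1) * u j := by
  conv_lhs => rw [pi_eq_sum_univ' u]
  rw [map_sum]
  refine Finset.sum_congr rfl fun j _ => ?_
  rw [map_smul, smul_eq_mul, mul_comm]

theorem coordR_cast (k : Fin n) (u : Fin n → ℤ) :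
    coordR b k (fun j => (u j : ℝ)) = (b.coord k u : ℝ) := by
  rw [coord_eq_sum]
  simp [coordR]

theorem sum_coordR (x : Fin n → ℝ) (l : Fin n) : x l = ∑ k, coordR b k x * (b k l : ℝ) := by
  have key : ∀ j, ∑ k, ((b.coord k (Pi.single j 1) : ℤ) : ℝ) * (b k l : ℝ)
      = if l = j then 1 else 0 := by
    intro j
    have h := congrFun (b.sum_repr (Pi.single j 1)) l
    simp only [Finset.sum_apply, Pi.smul_apply, smul_eq_mul, Pi.single_apply] at h
    simp only [Module.Basis.coord_apply]
    exact_mod_cast h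
  simp only [coordR, LinearMap.sum_apply, LinearMap.smul_apply, LinearMap.proj_apply, smul_eq_mul,
    Finset.sum_mul]
  rw [Finset.sum_comm]
  have : ∀ j, ∑ k, ((b.coord k (Pi.single j 1) : ℤ) : ℝ) * x j * (b k l : ℝ)
      = x j * if l = j then 1 else 0 := by
    intro j
    rw [← key j, Finset.mul_sum]
    exact Finset.sum_congr rfl fun k _ => by ring
  rw [Finset.sum_congr rfl fun j _ => this j]
  simp

end linear_algebra

variable {n : ℕ} (Δ : NonsingularCompleteFan n)

theorem card_le {I : Finset (Fin Δ.m)} (hI : I ∈ Δ.simplices) : I.card ≤ n := by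
  obtain ⟨_, e, _⟩ := Δ.nonsingular I hI
  simpa using Fintype.card_le_of_embedding e

/-- In a complete fan every cone is a face of an `n`-dimensional cone. -/
theorem exists_facet {I : Finset (Fin Δ.m)} (hI : I ∈ Δ.simplices) :
    ∃ K ∈ Δ.simplices, K.card = n ∧ I ⊆ K := by
  classical
  let v : Fin Δ.m → Fin n → ℝ := fun i j => (Δ.ray i j : ℝ)
  have memcone : ∀ (K : Finset (Fin Δ.m)) (x : Fin n → ℝ), x ∈ rayCone Δ.ray K ↔
      ∃ a : Fin Δ.m → ℝ, (∀ i, 0 ≤ a i) ∧ x = ∑ i ∈ K, a i • v i := by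
    intro K x
    constructor
    · rintro ⟨a, ha, h⟩
      exact ⟨a, ha, funext fun j => by simp [h j, v]⟩
    · rintro ⟨a, ha, rfl⟩
      exact ⟨a, ha, fun j => by simp [v]⟩
  -- a generic direction
  let S : Finset (Subspace ℝ (Fin n → ℝ)) :=
    ((Finset.univ : Finset (Finset (Fin Δ.m))).filter (fun K => K.card < n)).image
      (fun K => Submodule.span ℝ ((K.image v : Finset (Fin n → ℝ)) : Set (Fin n → ℝ)))
  have hS : ⊤ ∉ S := by
    intro h
    obtain ⟨K, hK, hKt⟩ := Finset.mem_image.1 h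
    have h1 := finrank_span_finset_le_card (R := ℝ) (K.image v)
    have h2 : (K.image v).card ≤ K.card := Finset.card_image_le
    rw [Set.finrank, hKt] at h1
    simp only [finrank_top, Module.finrank_fintype_fun_eq_card, Fintype.card_fin] at h1
    have := (Finset.mem_filter.1 hK).2
    omega
  obtain ⟨y, hy⟩ : ∃ y : Fin n → ℝ, ∀ K : Finset (Fin Δ.m), K.card < n →
      y ∉ Submodule.span ℝ ((K.image v : Finset (Fin n → ℝ)) : Set (Fin n → ℝ)) := by
    have := Subspace.biUnion_ne_univ_of_top_notMem hS
    obtain ⟨y, hy⟩ := (Set.ne_univ_iff_exists_notMem _).1 this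
    refine ⟨y, fun K hK hmem => hy ?_⟩
    simp only [Set.mem_iUnion]
    exact ⟨_, Finset.mem_image.2 ⟨K, Finset.mem_filter.2 ⟨Finset.mem_univ _, hK⟩, rfl⟩, hmem⟩
  let t : ℕ → ℝ := fun k => 1 / ((k : ℝ) + 1)
  let x : Fin n → ℝ := ∑ i ∈ I, v i
  choose F hF hFx using fun k : ℕ => Δ.complete (x + t k • y)
  obtain ⟨K, hKinf⟩ := Finite.exists_infinite_fiber F
  have hKinf' : (F ⁻¹' {K}).Infinite := Set.infinite_coe_iff.1 hKinf
  have hKx : ∀ k ∈ F ⁻¹' {K}, x + t k • y ∈ rayCone Δ.ray K := by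
    intro k hk
    have := hFx k
    rwa [show F k = K from hk] at this
  have hKmem : K ∈ Δ.simplices := by
    obtain ⟨k, hk⟩ := hKinf'.nonempty
    have := hF k
    rwa [show F k = K from hk] at this
  have hspan : ∀ z ∈ rayCone Δ.ray K,
      z ∈ Submodule.span ℝ ((K.image v : Finset (Fin n → ℝ)) : Set (Fin n → ℝ)) := by
    intro z hz
    obtain ⟨a, _, rfl⟩ := (memcone K z).1 hz
    refine Submodule.sum_mem _ fun i hi => Submodule.smul_mem _ _ (Submodule.subset_span ?_)
    exact Finset.mem_coe.2 (Finset.mem_image_of_mem v hi)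
  have hcard : K.card = n := by
    by_contra hne
    have hlt : K.card < n := lt_of_le_of_ne (Δ.card_le hKmem) hne
    obtain ⟨k, hk⟩ := hKinf'.nonempty
    obtain ⟨k', hk', hkk'⟩ := hKinf'.exists_gt k
    have h := Submodule.sub_mem _ (hspan _ (hKx k hk)) (hspan _ (hKx k' hk'))
    have he : (x + t k • y) - (x + t k' • y) = (t k - t k') • y := by
      rw [sub_smul]; abel
    rw [he] at h
    have htne : t k - t k' ≠ 0 := by
      have h1 : t k' < t k := by
        have : (k : ℝ) < k' := by exact_mod_cast hkk'
        exact one_div_lt_one_div_of_lt (by positivity) (by linarith)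
      exact (sub_pos.2 h1).ne'
    exact hy K hlt ((Submodule.smul_mem_iff _ htne).1 h)
  refine ⟨K, hKmem, hcard, ?_⟩
  obtain ⟨b, e, hbe⟩ := Δ.nonsingular K hKmem
  have ebij : Function.Bijective e :=
    (Fintype.bijective_iff_injective_and_card e).2 ⟨e.injective, by simp [hcard]⟩
  have coordsum : ∀ (L : Finset (Fin Δ.m)) (b : Module.Basis (Fin n) ℤ (Fin n → ℤ))
      (e : L ↪ Fin n), (∀ i : L, b (e i) = Δ.ray i) → ∀ (a : Fin Δ.m → ℝ) (i : L),
      coordR b (e i) (∑ l ∈ L, a l • v l) = a i := by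
    intro L b e hbe a i
    rw [map_sum, ← Finset.sum_coe_sort, Finset.sum_eq_single i]
    · rw [map_smul, show v i = fun j => ((Δ.ray i j : ℤ) : ℝ) from rfl, coordR_cast, ← hbe i]
      simp
    · intro l _ hl
      rw [map_smul, show v l = fun j => ((Δ.ray l j : ℤ) : ℝ) from rfl, coordR_cast, ← hbe l]
      have : e l ≠ e i := fun h => hl (e.injective h)
      simp [this]
    · simp
  -- the limit point lies in the closed cone
  have hxK : x ∈ rayCone Δ.ray K := by
    have hnonneg : ∀ i : K, 0 ≤ coordR b (e i) x := by
      intro i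
      by_contra hneg
      push Not at hneg
      set A := coordR b (e i) x
      set B := coordR b (e i) y
      obtain ⟨N, hN⟩ := exists_nat_gt (|B| / (-A))
      obtain ⟨k, hk, hkN⟩ := hKinf'.exists_gt N
      obtain ⟨a, ha, hax⟩ := (memcone K _).1 (hKx k hk)
      have h1 : 0 ≤ A + t k * B := by
        have := coordsum K b e hbe a i
        rw [← hax, map_add, map_smul, smul_eq_mul] at this
        rw [this]; exact ha i
      have hkN' : (N : ℝ) < k := by exact_mod_cast hkN
      have hpos : (0 : ℝ) < (k : ℝ) + 1 := by positivity
      have h2 : |B| < ((k : ℝ) + 1) * (-A) := by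
        rw [div_lt_iff₀ (by linarith)] at hN
        nlinarith
      have h3 : t k * B ≤ t k * |B| :=
        mul_le_mul_of_nonneg_left (le_abs_self B) (by positivity)
      have h4 : t k * |B| < -A := by
        have : t k * (((k : ℝ) + 1) * (-A)) = -A := by
          simp only [t]; field_simp
        rw [← this]
        exact mul_lt_mul_of_pos_left h2 (by positivity)
      linarith
    refine ⟨fun i => if h : i ∈ K then coordR b (e ⟨i, h⟩) x else 0, ?_, ?_⟩
    · intro i
      by_cases h : i ∈ K
      · simpa [h] using hnonneg ⟨i, h⟩
      · simp [h]
    · intro j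
      refine (sum_coordR b x j).trans (((Equiv.ofBijective e ebij).sum_comp
          (fun k => coordR b k x * (b k j : ℝ))).symm.trans ?_)
      refine Eq.trans ?_ (Finset.sum_coe_sort K _)
      refine Finset.sum_congr rfl fun i _ => ?_
      have : b (e i) j = Δ.ray i j := congrFun (hbe i) j
      simp [this]
  have hxI : x ∈ rayCone Δ.ray I := (memcone I x).2 ⟨fun _ => 1, by simp, by simp [x]⟩
  have hxIK : x ∈ rayCone Δ.ray (I ∩ K) := by
    rw [← Δ.inter I hI K hKmem]; exact ⟨hxI, hxK⟩
  obtain ⟨a, _, ha⟩ := (memcone _ _).1 hxIK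
  obtain ⟨b', e', hbe'⟩ := Δ.nonsingular I hI
  intro i hi
  by_contra hiK
  have h1 : coordR b' (e' ⟨i, hi⟩) x = 1 := by
    have := coordsum I b' e' hbe' (fun _ => 1) ⟨i, hi⟩
    simpa [x] using this
  have h2 : x = ∑ l ∈ I, (if l ∈ K then a l else 0) • v l := by
    rw [ha, ← Finset.filter_mem_eq_inter, Finset.sum_filter]
    exact Finset.sum_congr rfl fun l _ => by split_ifs <;> simp
  have h3 := coordsum I b' e' hbe' (fun l => if l ∈ K then a l else 0) ⟨i, hi⟩
  rw [← h2, h1] at h3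
  simp [hiK] at h3

/-- The `n`-dimensional cones of the fan. -/
def Facet : Type := {I : Finset (Fin Δ.m) // I ∈ Δ.simplices ∧ I.card = n}

variable {Δ}

namespace Facet

variable (I : Δ.Facet)

theorem exists_basis : ∃ (b : Module.Basis (Fin n) ℤ (Fin n → ℤ)) (e : I.1 ≃ Fin n),
    ∀ i : I.1, b (e i) = Δ.ray i := by
  obtain ⟨b, e, h⟩ := Δ.nonsingular I.1 I.2.1
  refine ⟨b, Equiv.ofBijective e ((Fintype.bijective_iff_injective_and_card e).2
    ⟨e.injective, by simp [I.2.2]⟩), h⟩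

/-- The basis of `ℤ^n` formed by the generators of an `n`-dimensional cone. -/
def basis : Module.Basis (Fin n) ℤ (Fin n → ℤ) := I.exists_basis.choose

/-- The enumeration of the rays of an `n`-dimensional cone underlying `Facet.basis`. -/
def idx : I.1 ≃ Fin n := I.exists_basis.choose_spec.choose

theorem basis_idx (i : I.1) : I.basis (I.idx i) = Δ.ray i :=
  I.exists_basis.choose_spec.choose_spec i

/-- The pairing of the `k`-th element of the dual basis of `Facet.basis` with the ray `j`. -/
def pairing (k : Fin n) (j : Fin Δ.m) : ℤ := I.basis.coord k (Δ.ray j)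

theorem pairing_of_mem (k : Fin n) (j : I.1) :
    I.pairing k j = if I.idx j = k then 1 else 0 := by
  rw [pairing, ← I.basis_idx j]
  simp [Finsupp.single_apply]

theorem pairing_eq_sum (k : Fin n) (j : Fin Δ.m) :
    I.pairing k j = ∑ l, I.basis.coord k (Pi.single l 1) * Δ.ray j l := coord_eq_sum _ _ _

theorem ray_eq_sum (j : Fin Δ.m) (l : Fin n) :
    Δ.ray j l = ∑ k, I.pairing k j * I.basis k l := by
  have h := congrFun (I.basis.sum_repr (Δ.ray j)) l
  simp only [Finset.sum_apply, Pi.smul_apply, smul_eq_mul] at h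
  exact h.symm

end Facet

variable (Δ)

/-- The homomorphism `λ : (ℂ^*)^m → (ℂ^*)^n`,
`λ(h)_l = ∏_i h_i ^ (l-th coordinate of the i-th ray)`. -/
def lam : CTorus Δ.m →* CTorus n where
  toFun h := CTorus.ofCoords fun l => ∏ i, CTorus.coord i h ^ Δ.ray i l
  map_one' := CTorus.ext_coord fun l => by simp [CTorus.coord_ofCoords]
  map_mul' g h := CTorus.ext_coord fun l => by
    simp [CTorus.coord_ofCoords, mul_zpow, Finset.prod_mul_distrib]

theorem coord_lam (h : CTorus Δ.m) (l : Fin n) :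
    CTorus.coord l (Δ.lam h) = ∏ i, CTorus.coord i h ^ Δ.ray i l := CTorus.coord_ofCoords _ _

theorem coe_lam (h : CTorus Δ.m) (l : Fin n) :
    (Δ.lam h : Fin n → ℂ) l = ∏ i, (h : Fin Δ.m → ℂ) i ^ Δ.ray i l := by
  rw [← CTorus.coe_coord, coord_lam]
  simp [CTorus.coe_coord]

theorem lam_surjective : Function.Surjective Δ.lam := by
  classical
  intro g
  obtain ⟨K, hK, hKn, _⟩ := Δ.exists_facet Δ.empty_mem
  let I : Δ.Facet := ⟨K, hK, hKn⟩
  let u : Fin n → ℂˣ := fun k => ∏ l, CTorus.coord l g ^ I.basis.coord k (Pi.single l 1)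
  refine ⟨CTorus.ofCoords fun i => if h : i ∈ I.1 then u (I.idx ⟨i, h⟩) else 1, ?_⟩
  refine CTorus.ext_coord fun l => ?_
  rw [coord_lam]
  simp only [CTorus.coord_ofCoords]
  have h1 : ∏ i, (if h : i ∈ I.1 then u (I.idx ⟨i, h⟩) else 1) ^ Δ.ray i l
      = ∏ k, u k ^ I.basis k l := by
    rw [← Finset.prod_subset (Finset.subset_univ I.1), ← Finset.prod_coe_sort,
      ← I.idx.prod_comp]
    · refine Finset.prod_congr rfl fun i _ => ?_
      simp [I.basis_idx]
    · intro i _ hi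
      simp [hi]
  rw [h1]
  have h2 : ∀ k, u k ^ I.basis k l
      = ∏ l', CTorus.coord l' g ^ (I.basis.coord k (Pi.single l' 1) * I.basis k l) := by
    intro k
    simp only [u]
    rw [← Finset.prod_zpow]
    exact Finset.prod_congr rfl fun _ _ => (zpow_mul _ _ _).symm
  simp only [h2]
  rw [Finset.prod_comm]
  have h3 : ∀ l', ∏ k, CTorus.coord l' g ^ (I.basis.coord k (Pi.single l' 1) * I.basis k l)
      = CTorus.coord l' g ^ (if l = l' then (1 : ℤ) else 0) := by
    intro l'
    rw [prod_zpow_exp]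
    have h := congrFun (I.basis.sum_repr (Pi.single l' 1)) l
    simp only [Finset.sum_apply, Pi.smul_apply, smul_eq_mul, Pi.single_apply] at h
    simp only [Module.Basis.coord_apply]
    rw [h]
  simp only [h3]
  rw [Finset.prod_eq_single l]
  · simp
  · intro l' _ hl'
    simp [Ne.symm hl']
  · simp

/-- The open subset `U(Σ) ⊆ ℂ^m` of points whose vanishing coordinates are contained in a simplex. -/
def U : Set (Fin Δ.m → ℂ) := {z | ∃ I ∈ Δ.simplices, ∀ i, i ∉ I → z i ≠ 0}

/-- The coordinatewise action of `(ℂ^*)^m` on `U(Σ)`. -/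
instance : MulAction (CTorus Δ.m) Δ.U where
  smul h z := ⟨fun i => (h : Fin Δ.m → ℂ) i * z.1 i, by
    obtain ⟨I, hI, hz⟩ := z.2
    exact ⟨I, hI, fun i hi => mul_ne_zero (CTorus.coord i h).ne_zero (hz i hi)⟩⟩
  one_smul z := Subtype.ext (funext fun i => one_mul _)
  mul_smul g h z := Subtype.ext (funext fun i => mul_assoc _ _ _)

theorem smul_apply (h : CTorus Δ.m) (z : Δ.U) (i : Fin Δ.m) :
    (h • z).1 i = (h : Fin Δ.m → ℂ) i * z.1 i := rfl

/-- The toric manifold (nonsingular complete toric variety over `ℂ`) of a nonsingular complete fan,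
as the quotient `U(Σ) / ker λ` (homogeneous coordinates). Its topology, its action of `(ℂ^*)^n` and
its complex manifold structure, given by the affine charts `U(I) / ker λ ≅ ℂ^n` of the
`n`-dimensional cones `I`, whose transition maps are Laurent monomials, are constructed below. -/
def ToricManifold : Type := Quotient (MulAction.orbitRel Δ.lam.ker Δ.U)

namespace ToricManifold

/-- The quotient topology. -/
instance : TopologicalSpace Δ.ToricManifold :=
  inferInstanceAs (TopologicalSpace (Quotient (MulAction.orbitRel Δ.lam.ker Δ.U)))

/-- The quotient map `U(Σ) → U(Σ) / ker λ`. -/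
def mk (z : Δ.U) : Δ.ToricManifold := Quotient.mk (MulAction.orbitRel Δ.lam.ker Δ.U) z

variable {Δ}

theorem mk_surjective : Function.Surjective (mk Δ) := Quot.mk_surjective

theorem mk_eq_iff {z w : Δ.U} : mk Δ z = mk Δ w ↔ ∃ h : CTorus Δ.m, Δ.lam h = 1 ∧ h • w = z := by
  refine Iff.trans (Quotient.eq (r := MulAction.orbitRel Δ.lam.ker Δ.U)) ?_
  rw [MulAction.orbitRel_apply]
  constructor
  · rintro ⟨⟨h, hh⟩, e⟩
    exact ⟨h, hh, e⟩
  · rintro ⟨h, hh, e⟩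
    exact ⟨⟨h, hh⟩, e⟩

variable (Δ)

/-- The action of `(ℂ^*)^n ≅ (ℂ^*)^m / ker λ` induced from the action of `(ℂ^*)^m` on `U(Σ)`;
see `lam_smul_mk`. -/
instance : SMul (CTorus n) Δ.ToricManifold where
  smul g y := Quotient.map' (s₁ := MulAction.orbitRel Δ.lam.ker Δ.U)
    (s₂ := MulAction.orbitRel Δ.lam.ker Δ.U)
    (fun z : Δ.U => Function.surjInv Δ.lam_surjective g • z) (by
      rintro _ w ⟨h, rfl⟩
      refine ⟨h, ?_⟩
      change (h : CTorus Δ.m) • (Function.surjInv Δ.lam_surjective g • w)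
        = Function.surjInv Δ.lam_surjective g • ((h : CTorus Δ.m) • w)
      rw [smul_smul, smul_smul, mul_comm]) y

variable {Δ}

theorem lam_smul_mk (h : CTorus Δ.m) (z : Δ.U) : Δ.lam h • mk Δ z = mk Δ (h • z) := by
  change mk Δ (Function.surjInv Δ.lam_surjective (Δ.lam h) • z) = _
  rw [mk_eq_iff]
  refine ⟨Function.surjInv Δ.lam_surjective (Δ.lam h) * h⁻¹, ?_, ?_⟩
  · rw [map_mul, Function.surjInv_eq Δ.lam_surjective, map_inv, mul_inv_cancel]
  · rw [smul_smul, inv_mul_cancel_right]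

variable (Δ)

instance : MulAction (CTorus n) Δ.ToricManifold where
  one_smul y := by
    obtain ⟨z, rfl⟩ := mk_surjective y
    rw [← map_one Δ.lam, lam_smul_mk, one_smul]
  mul_smul g g' y := by
    obtain ⟨z, rfl⟩ := mk_surjective y
    obtain ⟨h, rfl⟩ := Δ.lam_surjective g
    obtain ⟨h', rfl⟩ := Δ.lam_surjective g'
    rw [← map_mul, lam_smul_mk, lam_smul_mk, lam_smul_mk, mul_smul]

variable {Δ}

theorem isOpenQuotientMap_mk : IsOpenQuotientMap (mk Δ) := by
  have : ContinuousConstSMul Δ.lam.ker Δ.U := by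
    refine ⟨fun h => Continuous.subtype_mk (continuous_pi fun i => ?_) _⟩
    exact continuous_const.mul ((continuous_apply i).comp continuous_subtype_val)
  exact MulAction.isOpenQuotientMap_quotientMk

variable (I : Δ.Facet)

/-- The monomials `∏_j z_j ^ ⟨α_k, v_j⟩` on `U(Σ)`, where `α_k` is the dual basis of the generators
`v_j` of the cone `I`. -/
def preChart (z : Δ.U) : Fin n → ℂ := fun k => ∏ j, z.1 j ^ I.pairing k j

theorem lam_pairing {h : CTorus Δ.m} (hh : Δ.lam h = 1) (k : Fin n) :
    ∏ j, (h : Fin Δ.m → ℂ) j ^ I.pairing k j = 1 := by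
  have h1 : ∀ j, (h : Fin Δ.m → ℂ) j ^ I.pairing k j
      = ∏ l, ((h : Fin Δ.m → ℂ) j ^ Δ.ray j l) ^ I.basis.coord k (Pi.single l 1) := by
    intro j
    have hne : (h : Fin Δ.m → ℂ) j ≠ 0 := (CTorus.coord j h).ne_zero
    rw [I.pairing_eq_sum, ← CTorus.coe_coord, ← Units.val_zpow_eq_zpow_val,
      ← prod_zpow_exp]
    push_cast
    exact Finset.prod_congr rfl fun l _ => by rw [mul_comm, zpow_mul]
  simp only [h1]
  rw [Finset.prod_comm]
  refine Finset.prod_eq_one fun l _ => ?_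
  rw [Finset.prod_zpow, ← coe_lam, hh]
  simp

theorem preChart_smul {h : CTorus Δ.m} (hh : Δ.lam h = 1) (z : Δ.U) :
    preChart I (h • z) = preChart I z := by
  funext k
  simp only [preChart, smul_apply, mul_zpow, Finset.prod_mul_distrib]
  rw [lam_pairing I hh, one_mul]

/-- The point of `U(Σ)` with coordinates `w` at the rays of the cone `I`, and `1` elsewhere. -/
def chartSection (w : Fin n → ℂ) : Δ.U :=
  ⟨fun j => if h : j ∈ I.1 then w (I.idx ⟨j, h⟩) else 1,
    I.1, I.2.1, fun i hi => by simp [hi]⟩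

theorem preChart_chartSection (w : Fin n → ℂ) : preChart I (chartSection I w) = w := by
  funext k
  simp only [preChart, chartSection]
  rw [← Finset.prod_subset (Finset.subset_univ I.1), ← Finset.prod_coe_sort,
    Finset.prod_eq_single (I.idx.symm k)]
  · have := I.pairing_of_mem k (I.idx.symm k)
    simp only [Equiv.apply_symm_apply, if_true] at this
    simp [this]
  · intro j _ hj
    have := I.pairing_of_mem k j
    rw [if_neg (fun h => hj (by rw [← h, Equiv.symm_apply_apply]))] at this
    simp [this]
  · simp
  · intro j _ hj
    simp [hj]

theorem mk_chartSection_preChart {z : Δ.U} (hz : ∀ i, i ∉ I.1 → z.1 i ≠ 0) :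
    mk Δ (chartSection I (preChart I z)) = mk Δ z := by
  classical
  rw [mk_eq_iff]
  let zu : Fin Δ.m → ℂˣ := fun j => if h : j ∈ I.1 then 1 else Units.mk0 (z.1 j) (hz j h)
  have zu_mem : ∀ j, j ∈ I.1 → zu j = 1 := fun j hj => by simp [zu, hj]
  have zu_not : ∀ j, j ∉ I.1 → ((zu j : ℂˣ) : ℂ) = z.1 j := fun j hj => by simp [zu, hj]
  let c : Fin Δ.m → ℂˣ := fun i =>
    if h : i ∈ I.1 then ∏ j, zu j ^ I.pairing (I.idx ⟨i, h⟩) j else (zu i)⁻¹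
  refine ⟨CTorus.ofCoords c, ?_, ?_⟩
  · refine CTorus.ext_coord fun l => ?_
    rw [coord_lam, map_one]
    simp only [CTorus.coord_ofCoords]
    have e1 : ∏ i, c i ^ Δ.ray i l
        = (∏ i ∈ I.1, c i ^ Δ.ray i l) * ∏ i ∈ I.1ᶜ, c i ^ Δ.ray i l :=
      (Finset.prod_mul_prod_compl _ _).symm
    have e2 : ∏ i ∈ I.1, c i ^ Δ.ray i l = ∏ j, zu j ^ Δ.ray j l := by
      rw [← Finset.prod_coe_sort]
      have : ∀ i : I.1, c i ^ Δ.ray i l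
          = ∏ j, zu j ^ (I.pairing (I.idx i) j * I.basis (I.idx i) l) := by
        intro i
        have hc : c i = ∏ j, zu j ^ I.pairing (I.idx i) j := by simp [c]
        rw [hc, I.basis_idx, ← Finset.prod_zpow]
        exact Finset.prod_congr rfl fun j _ => (zpow_mul _ _ _).symm
      simp only [this]
      rw [I.idx.prod_comp (fun k => ∏ j, zu j ^ (I.pairing k j * I.basis k l)), Finset.prod_comm]
      refine Finset.prod_congr rfl fun j _ => ?_
      rw [prod_zpow_exp, ← I.ray_eq_sum]
    have e3 : ∏ i ∈ I.1ᶜ, c i ^ Δ.ray i l = (∏ j, zu j ^ Δ.ray j l)⁻¹ := by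
      rw [← Finset.prod_inv_distrib, ← Finset.prod_subset (Finset.subset_univ I.1ᶜ)]
      · refine Finset.prod_congr rfl fun i hi => ?_
        simp [c, Finset.mem_compl.1 hi]
      · intro i _ hi
        rw [zu_mem i (by simpa using hi)]
        simp
    rw [e1, e2, e3, mul_inv_cancel]
  · refine Subtype.ext (funext fun i => ?_)
    rw [smul_apply, ← CTorus.coe_coord, CTorus.coord_ofCoords]
    by_cases hi : i ∈ I.1
    · have hs : (chartSection I (preChart I z)).1 i = preChart I z (I.idx ⟨i, hi⟩) := by
        simp [chartSection, hi]
      rw [hs]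
      have hc : c i = ∏ j, zu j ^ I.pairing (I.idx ⟨i, hi⟩) j := by simp [c, hi]
      rw [hc]
      simp only [preChart]
      rw [← Finset.prod_mul_prod_compl I.1 (fun j => z.1 j ^ I.pairing (I.idx ⟨i, hi⟩) j)]
      have f1 : ∏ j ∈ I.1, z.1 j ^ I.pairing (I.idx ⟨i, hi⟩) j = z.1 i := by
        rw [← Finset.prod_coe_sort, Finset.prod_eq_single ⟨i, hi⟩]
        · simp [I.pairing_of_mem _ ⟨i, hi⟩]
        · intro j _ hj
          rw [I.pairing_of_mem _ j, if_neg (fun h => hj (I.idx.injective h))]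
          simp
        · simp
      have f2 : ((∏ j, zu j ^ I.pairing (I.idx ⟨i, hi⟩) j : ℂˣ) : ℂ)
          = ∏ j ∈ I.1ᶜ, z.1 j ^ I.pairing (I.idx ⟨i, hi⟩) j := by
        rw [← Finset.prod_subset (Finset.subset_univ I.1ᶜ)]
        · push_cast
          exact Finset.prod_congr rfl fun j hj => by rw [zu_not j (Finset.mem_compl.1 hj)]
        · intro j _ hj
          rw [zu_mem j (by simpa using hj)]
          simp
      rw [f1, f2]
      ring
    · have hs : (chartSection I (preChart I z)).1 i = 1 := by simp [chartSection, hi]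
      rw [hs]
      have hc : c i = (zu i)⁻¹ := by simp [c, hi]
      rw [hc, ← zu_not i hi]
      simp

/-- The domain of the chart of the cone `I`, namely `U(I) / ker λ`. -/
def chartSource : Set Δ.ToricManifold := mk Δ '' {z | ∀ i, i ∉ I.1 → z.1 i ≠ 0}

theorem mk_mem_chartSource {z : Δ.U} :
    mk Δ z ∈ chartSource I ↔ ∀ i, i ∉ I.1 → z.1 i ≠ 0 := by
  constructor
  · rintro ⟨w, hw, h⟩ i hi
    obtain ⟨g, _, rfl⟩ := mk_eq_iff.1 h
    exact right_ne_zero_of_mul (hw i hi)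
  · intro h
    exact ⟨z, h, rfl⟩

theorem isOpen_preChartSource : IsOpen {z : Δ.U | ∀ i, i ∉ I.1 → z.1 i ≠ 0} := by
  have : {z : Δ.U | ∀ i, i ∉ I.1 → z.1 i ≠ 0}
      = ⋂ i : Fin Δ.m, {z : Δ.U | i ∉ I.1 → z.1 i ≠ 0} := by
    ext z; simp
  rw [this]
  refine isOpen_iInter_of_finite fun i => ?_
  by_cases hi : i ∈ I.1
  · simp [hi]
  · simp only [hi, not_false_eq_true, forall_true_left]
    exact isOpen_ne_fun ((continuous_apply i).comp continuous_subtype_val) continuous_const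

theorem isOpen_chartSource : IsOpen (chartSource I) :=
  isOpenQuotientMap_mk.isOpenMap _ (isOpen_preChartSource I)

/-- The map `[z] ↦ (∏_j z_j ^ ⟨α_k, v_j⟩)_k`. -/
def chartFun (y : Δ.ToricManifold) : Fin n → ℂ :=
  Quotient.liftOn' (s₁ := MulAction.orbitRel Δ.lam.ker Δ.U) y (preChart I) (by
    rintro _ w ⟨h, rfl⟩
    exact preChart_smul I h.2 w)

/-- The chart of the toric variety attached to an `n`-dimensional cone, in homogeneous
coordinates `[z] ↦ (∏_j z_j ^ ⟨α_k, v_j⟩)_k`. -/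
def chart : OpenPartialHomeomorph Δ.ToricManifold (Fin n → ℂ) where
  toFun := chartFun I
  invFun w := mk Δ (chartSection I w)
  source := chartSource I
  target := Set.univ
  map_source' _ _ := Set.mem_univ _
  map_target' w _ := (mk_mem_chartSource I).2 fun i hi => by simp [chartSection, hi]
  left_inv' := by
    rintro _ ⟨z, hz, rfl⟩
    exact mk_chartSection_preChart I hz
  right_inv' w _ := preChart_chartSection I w
  open_source := isOpen_chartSource I
  open_target := isOpen_univ
  continuousOn_toFun := by
    refine (isOpenQuotientMap_mk.isQuotientMap.continuousOn_isOpen_iff (g := chartFun I)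
      (isOpen_chartSource I)).2 ?_
    have : mk Δ ⁻¹' chartSource I = {z | ∀ i, i ∉ I.1 → z.1 i ≠ 0} := by
      ext z; exact mk_mem_chartSource I
    rw [this]
    change ContinuousOn (preChart I) _
    refine continuousOn_pi.2 fun k => continuousOn_finsetProd _ fun j _ => ?_
    refine ContinuousOn.zpow₀ ((continuous_apply j).comp continuous_subtype_val).continuousOn _ ?_
    intro z hz
    by_cases hj : j ∈ I.1
    · right
      rw [I.pairing_of_mem k ⟨j, hj⟩]
      split_ifs <;> simp
    · exact Or.inl (hz j hj)
  continuousOn_invFun := by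
    refine Continuous.continuousOn (isOpenQuotientMap_mk.continuous.comp ?_)
    refine Continuous.subtype_mk (continuous_pi fun j => ?_) _
    by_cases hj : j ∈ I.1
    · simpa [hj] using continuous_apply _
    · simpa [hj] using continuous_const

theorem chart_mk (z : Δ.U) : chart I (mk Δ z) = preChart I z := rfl

theorem chart_symm (w : Fin n → ℂ) : (chart I).symm w = mk Δ (chartSection I w) := rfl

theorem exists_mem_chart_source (y : Δ.ToricManifold) : ∃ I : Δ.Facet, y ∈ (chart I).source := by
  obtain ⟨z, rfl⟩ := mk_surjective y
  obtain ⟨K, hK, hz⟩ := z.2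
  obtain ⟨L, hL, hLn, hKL⟩ := Δ.exists_facet hK
  exact ⟨⟨L, hL, hLn⟩, (mk_mem_chartSource _).2 fun i hi => hz i fun h => hi (hKL h)⟩

variable (Δ)

/-- The atlas of the toric variety consisting of the charts of all `n`-dimensional cones. -/
instance : ChartedSpace (Fin n → ℂ) Δ.ToricManifold where
  atlas := Set.range chart
  chartAt y := chart (exists_mem_chart_source y).choose
  mem_chart_source y := (exists_mem_chart_source y).choose_spec
  chart_mem_atlas _ := Set.mem_range_self _

/-- The toric variety is a complex manifold. -/
instance : IsManifold 𝓘(ℂ, Fin n → ℂ) ω Δ.ToricManifold := by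
  refine isManifold_of_contDiffOn _ _ _ ?_
  rintro _ _ ⟨I, rfl⟩ ⟨K, rfl⟩
  intro w hw
  have hw' : ∀ j, j ∉ K.1 → (chartSection I w).1 j ≠ 0 := by
    have : (chart I).symm w ∈ (chart K).source := (by simpa using hw.1 :
      w ∈ (chart I).target ∧ (chart I).symm w ∈ (chart K).source).2
    exact (mk_mem_chartSource K).1 this
  refine ContDiffAt.contDiffWithinAt ?_
  change ContDiffAt ℂ ω (fun w => preChart K (chartSection I w)) w
  refine contDiffAt_pi.2 fun k => ?_
  refine AnalyticAt.contDiffAt ?_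
  unfold preChart
  refine Finset.analyticAt_fun_prod _ fun j _ => ?_
  have hs : AnalyticAt ℂ (fun w : Fin n → ℂ => (chartSection I w).1 j) w := by
    by_cases hj : j ∈ I.1
    · simp only [chartSection, hj, dif_pos]
      exact (ContinuousLinearMap.proj (R := ℂ) (φ := fun _ : Fin n => ℂ)
        (I.idx ⟨j, hj⟩)).analyticAt w
    · simpa [chartSection, hj] using analyticAt_const
  by_cases hj : j ∈ K.1
  · refine hs.zpow_nonneg ?_
    rw [K.pairing_of_mem k ⟨j, hj⟩]
    split_ifs <;> simp
  · exact hs.zpow (hw' j hj)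

end ToricManifold

end NonsingularCompleteFan

/-! ### Topological toric manifolds -/

/-- A one-dimensional smooth complex representation `(ℂ^*)^n → GL_1(ℂ) = ℂ^*`. -/
structure SmoothCharacter (n : ℕ) where
  /-- the underlying homomorphism -/
  toHom : CTorus n →* ℂˣ
  smooth : ContMDiff 𝓘(ℝ, Fin n → ℂ) 𝓘(ℝ, ℂ) ∞ toHom

section manifolds

variable (n : ℕ) (X : Type*) [TopologicalSpace X] [ChartedSpace (EuclideanSpace ℝ (Fin (2 * n))) X]

/-- An equivariant chart of a `2n`-dimensional manifold with an action of `(ℂ^*)^n`: an equivariant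
diffeomorphism from an invariant open subset onto a direct sum `V(χ_1) ⊕ ⋯ ⊕ V(χ_n) = ℂ^n` of
one-dimensional smooth complex representations `χ_i` of `(ℂ^*)^n`. -/
structure EquivariantChart [MulAction (CTorus n) X]
    extends OpenPartialHomeomorph X (Fin n → ℂ) where
  /-- the characters `χ_i` -/
  weight : Fin n → SmoothCharacter n
  target_eq : target = Set.univ
  smul_mem : ∀ (g : CTorus n), ∀ x ∈ source, g • x ∈ source
  smooth : ContMDiffOn (𝓡 (2 * n)) 𝓘(ℝ, Fin n → ℂ) ∞ toOpenPartialHomeomorph source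
  smooth_symm : ContMDiffOn 𝓘(ℝ, Fin n → ℂ) (𝓡 (2 * n)) ∞ toOpenPartialHomeomorph.symm target
  equivariant : ∀ (g : CTorus n), ∀ x ∈ source, ∀ i,
    toOpenPartialHomeomorph (g • x) i = ((weight i).toHom g : ℂ) * toOpenPartialHomeomorph x i

/-- A topological toric manifold of dimension `2n`: a closed (compact Hausdorff) smooth manifold with an effective
smooth action of `(ℂ^*)^n` having an open dense orbit, which is covered by invariant open subsets
equivariantly diffeomorphic to direct sums of one-dimensional smooth complex representations. -/
structure IsTopologicalToricManifold [IsManifold (𝓡 (2 * n)) ∞ X] [MulAction (CTorus n) X] : Prop where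
  compactSpace : CompactSpace X
  t2Space : T2Space X
  smooth_smul : ContMDiff (𝓘(ℝ, Fin n → ℂ).prod (𝓡 (2 * n))) (𝓡 (2 * n)) ∞
    (fun p : CTorus n × X => p.1 • p.2)
  effective : ∀ g : CTorus n, (∀ x : X, g • x = x) → g = 1
  exists_orbit : ∃ x : X, IsOpen (MulAction.orbit (CTorus n) x) ∧
    Dense (MulAction.orbit (CTorus n) x)
  exists_chart : ∀ x : X, ∃ φ : EquivariantChart n X, x ∈ φ.source

/-- A (smooth) almost complex structure on `X`: a smooth bundle endomorphism `J` of the tangent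
bundle with `J ^ 2 = -1`. -/
structure AlmostComplexStructure [IsManifold (𝓡 (2 * n)) ∞ X] where
  /-- the endomorphisms of the tangent spaces -/
  toFun : ∀ x : X, TangentSpace (𝓡 (2 * n)) x →L[ℝ] TangentSpace (𝓡 (2 * n)) x
  sq : ∀ x v, toFun x (toFun x v) = -v
  smooth : ContMDiff (𝓡 (2 * n)).tangent (𝓡 (2 * n)).tangent ∞
    (fun p : TangentBundle (𝓡 (2 * n)) X =>
      (⟨p.1, toFun p.1 p.2⟩ : TangentBundle (𝓡 (2 * n)) X))

end manifolds

namespace AlmostComplexStructure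

variable {n : ℕ} {X : Type*} [TopologicalSpace X]
  [ChartedSpace (EuclideanSpace ℝ (Fin (2 * n))) X] [IsManifold (𝓡 (2 * n)) ∞ X]
  (J : AlmostComplexStructure n X)

/-- `J` is invariant under the action of `(ℂ^*)^n`: it commutes with the differentials of the
action. -/
def IsInvariant [MulAction (CTorus n) X] : Prop :=
  ∀ (g : CTorus n) (x : X) (v : TangentSpace (𝓡 (2 * n)) x),
    mfderiv (𝓡 (2 * n)) (𝓡 (2 * n)) (fun y : X => g • y) x (J.toFun x v) =
      J.toFun (g • x) (mfderiv (𝓡 (2 * n)) (𝓡 (2 * n)) (fun y : X => g • y) x v)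

/-- A map `f` from `(X, J)` to an `n`-dimensional complex manifold `N` (for instance `ℂ^n`) is
holomorphic on the set `s`: it is smooth on `s` and `df (J v) = √-1 df v`. In Mathlib the tangent
space of `N` at `y` is `ℂ^n`, identified through the preferred (holomorphic) chart at `y`, so that
scalar multiplication by `√-1` on `ℂ^n` is the complex structure of the tangent space. -/
def IsHolomorphicOn {N : Type*} [TopologicalSpace N] [ChartedSpace (Fin n → ℂ) N]
    (f : X → N) (s : Set X) : Prop :=
  ContMDiffOn (𝓡 (2 * n)) 𝓘(ℝ, Fin n → ℂ) ∞ f s ∧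
  ∀ x ∈ s, ∀ v : TangentSpace (𝓡 (2 * n)) x,
    let df : TangentSpace (𝓡 (2 * n)) x → (Fin n → ℂ) := fun u =>
      mfderiv (𝓡 (2 * n)) 𝓘(ℝ, Fin n → ℂ) f x u
    df (J.toFun x v) = Complex.I • df v

/-- `J` is integrable: it is induced by a complex structure on `X`, that is, around every point
there is a smooth chart with values in `ℂ^n` that is holomorphic with respect to `J`. (The
transition maps between such charts are then holomorphic.) -/
def IsIntegrable : Prop :=
  ∀ x : X, ∃ φ : OpenPartialHomeomorph X (Fin n → ℂ), x ∈ φ.source ∧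
    J.IsHolomorphicOn φ φ.source ∧
    ContMDiffOn 𝓘(ℝ, Fin n → ℂ) (𝓡 (2 * n)) ∞ φ.symm φ.target

/-- An equivariant chart is compatible with the omniorientation determined by `J`: the chart maps
the orientation of the normal bundle of each characteristic submanifold `{φ_i = 0}` given by `J` to
the standard orientation. As `dφ_i` identifies the normal spaces with `ℂ`, this says that
`(dφ_i ξ, dφ_i (J ξ))` is a positively oriented real basis of `ℂ` for every `ξ` that is not tangent
to `{φ_i = 0}`. -/
def IsCompatible [MulAction (CTorus n) X] (φ : EquivariantChart n X) : Prop :=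
  ∀ i, ∀ x ∈ φ.source, φ.toOpenPartialHomeomorph x i = 0 →
    ∀ ξ : TangentSpace (𝓡 (2 * n)) x,
      let dφ : TangentSpace (𝓡 (2 * n)) x → (Fin n → ℂ) := fun u =>
        mfderiv (𝓡 (2 * n)) 𝓘(ℝ, Fin n → ℂ) φ.toOpenPartialHomeomorph x u
      dφ ξ i ≠ 0 → 0 < ((starRingEnd ℂ) (dφ ξ i) * dφ (J.toFun x ξ) i).im

end AlmostComplexStructure

end

/-!
Let `T = (ℂ^*)^n`. In an equivariant chart the torus acts through a homomorphism `T → T` given by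
`n` smooth characters. In logarithmic coordinates it is a real-linear map, because a smooth
character solves the differential equation of the exponential function along each line
(`SmoothCharacter.exists_log`). It is injective because the action is effective and the domain of
the chart is dense, hence it is bijective with smooth inverse, and the almost complex structure `J`
transported to `ℂ^n` is invariant under the coordinatewise action of all of `T`. Real homotheties
contract `ℂ^n` to the origin, so by continuity the transported structure is constant; a constant
endomorphism that commutes with `T` is diagonal, and its square is `-1`, so it multiplies each
coordinate by `√-1` or `-√-1` (`exists_eps_of_invariant`). Compatibility, tested at the origin,
says that all signs are positive, that is, that the chart is holomorphic. In general it suffices to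
conjugate the coordinates with a negative sign. This settles integrability and the statements on
charts.

For the comparison with a toric manifold, normalize the holomorphic charts at a base point of the
open orbit. The transition map between two of them is a homomorphism on the open orbit whose
logarithm is linear over `ℂ` and preserves the periods `2π√-1 ℤ^n`, so it is given by Laurent
monomials (`EquivariantChart.IsAdapted.exists_matrix`). The rest only uses that `X` is a compact
Hausdorff space with a finite atlas of this kind (`MonomialAtlas`). The rays of the fan are the
one-parameter subgroups that are coordinate axes in some chart, and the maximal cones are given by
the charts. Compactness provides limit points of one-parameter semigroups, which makes the fan
complete; uniqueness of the limits, together with the fact that the rays of the coordinate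
hyperplanes through a point do not depend on the chart (`MonomialAtlas.exists_ray_eq`), shows that
cones meet in common faces. The same two facts show that the charts glue to a bijection
`MonomialAtlas.toToric` from `X` to the toric manifold of the fan, which in the affine charts is
the identity up to a permutation of the coordinates.
-/

noncomputable section

/-! ### The exponential map of the torus and smooth characters -/

namespace CTorus

variable {n : ℕ}

/-- The exponential map `ℂ^n → (ℂ^*)^n`, coordinatewise. -/
def exp (w : Fin n → ℂ) : CTorus n :=
  ofCoords fun i => Units.mk0 (Complex.exp (w i)) (Complex.exp_ne_zero _)

theorem coe_exp (w : Fin n → ℂ) (i : Fin n) : (exp w : Fin n → ℂ) i = Complex.exp (w i) := rfl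

theorem coe_ne_zero (g : CTorus n) (i : Fin n) : (g : Fin n → ℂ) i ≠ 0 := (coord i g).ne_zero

theorem ext_coe {g h : CTorus n} (H : ∀ i, (g : Fin n → ℂ) i = (h : Fin n → ℂ) i) : g = h :=
  Units.ext (funext H)

theorem exp_add (w w' : Fin n → ℂ) : exp (w + w') = exp w * exp w' :=
  ext_coe fun i => by simp [coe_exp, Complex.exp_add]

theorem exp_zero : exp (0 : Fin n → ℂ) = 1 := ext_coe fun i => by simp [coe_exp]

theorem exp_surjective : Function.Surjective (exp : (Fin n → ℂ) → CTorus n) := fun g =>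
  ⟨fun i => Complex.log ((g : Fin n → ℂ) i), ext_coe fun i => by
    rw [coe_exp, Complex.exp_log (coe_ne_zero g i)]⟩

theorem exp_eq_one_iff {w : Fin n → ℂ} :
    exp w = 1 ↔ ∀ i, ∃ k : ℤ, w i = k * (2 * Real.pi * Complex.I) := by
  constructor
  · intro h i
    apply Complex.exp_eq_one_iff.1
    rw [← coe_exp, h]
    rfl
  · intro h
    refine ext_coe fun i => ?_
    rw [coe_exp, Complex.exp_eq_one_iff.2 (h i)]
    rfl

theorem contMDiff_exp :
    ContMDiff 𝓘(ℝ, Fin n → ℂ) 𝓘(ℝ, Fin n → ℂ) ∞ (exp : (Fin n → ℂ) → CTorus n) := by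
  apply ContMDiff.of_comp_isOpenEmbedding Units.isOpenEmbedding_val
  rw [contMDiff_iff_contDiff]
  refine contDiff_pi.2 fun i => ?_
  exact Complex.contDiff_exp.comp (contDiff_apply ℝ ℂ i)

/-- A one-parameter subgroup of the torus through a point off the identity is not constant. -/
theorem eq_zero_of_exp_smul_eq_one {w : Fin n → ℂ} (h : ∀ s : ℝ, exp (s • w) = 1) : w = 0 := by
  have key : ∀ s : ℝ, ∀ i, Complex.exp (s * w i) = 1 := by
    intro s i
    have := congrArg (fun g : CTorus n => (g : Fin n → ℂ) i) (h s)
    simpa [coe_exp] using this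
  funext i
  have h1 : HasDerivAt (fun s : ℝ => Complex.exp (s * w i))
      (Complex.exp ((0 : ℝ) * w i) * w i) 0 := by
    have := (Complex.ofRealCLM.hasDerivAt (x := 0)).mul_const (w i)
    simpa using this.cexp
  have h2 : (fun s : ℝ => Complex.exp (s * w i)) = fun _ => 1 := funext fun s => key s i
  rw [h2] at h1
  simpa using h1.unique (hasDerivAt_const (0 : ℝ) (1 : ℂ))

end CTorus

namespace SmoothCharacter

open CTorus

variable {n : ℕ}

theorem contDiff_comp_exp (χ : SmoothCharacter n) :
    ContDiff ℝ ∞ fun w : Fin n → ℂ => ((χ.toHom (exp w) : ℂˣ) : ℂ) := by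
  rw [← contMDiff_iff_contDiff]
  exact (Units.contMDiff_val (R := ℂ) (𝕜 := ℝ)).comp (χ.smooth.comp contMDiff_exp)

/-- In logarithmic coordinates a smooth character is real-linear: along each line, it solves the
differential equation of the exponential function. -/
theorem exists_log (χ : SmoothCharacter n) :
    ∃ ℓ : (Fin n → ℂ) →L[ℝ] ℂ, ∀ w, ((χ.toHom (exp w) : ℂˣ) : ℂ) = Complex.exp (ℓ w) := by
  set F : (Fin n → ℂ) → ℂ := fun w => ((χ.toHom (exp w) : ℂˣ) : ℂ) with hF
  have hadd : ∀ w w', F (w + w') = F w * F w' := fun w w' => by simp [hF, exp_add]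
  have h0 : F 0 = 1 := by simp [hF, exp_zero]
  have hdiff : HasFDerivAt F (fderiv ℝ F 0) 0 :=
    ((χ.contDiff_comp_exp.differentiable (by simp)) 0).hasFDerivAt
  refine ⟨fderiv ℝ F 0, fun w => ?_⟩
  set ℓ := fderiv ℝ F 0
  have hline : HasDerivAt (fun s : ℝ => F (s • w)) (ℓ w) 0 := by
    have h1 : HasDerivAt (fun s : ℝ => s • w) w 0 := by
      simpa using (hasDerivAt_id (0 : ℝ)).smul_const w
    have : HasFDerivAt F ℓ ((0 : ℝ) • w) := by simpa using hdiff
    exact this.comp_hasDerivAt (0 : ℝ) h1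
  have hline' : ∀ s : ℝ, HasDerivAt (fun s : ℝ => F (s • w)) (F (s • w) * ℓ w) s := by
    intro s
    have h2 : HasDerivAt (fun r : ℝ => F ((r - s) • w)) (ℓ w) s :=
      HasDerivAt.comp_sub_const s s (by simpa using hline)
    refine (h2.const_mul (F (s • w))).congr_of_eventuallyEq
      (Filter.Eventually.of_forall fun r => ?_)
    simp only
    rw [← hadd, ← add_smul]
    congr 2
    ring
  have hk : ∀ s : ℝ, HasDerivAt (fun s : ℝ => F (s • w) * Complex.exp (-(s * ℓ w))) 0 s := by
    intro s
    have h3 : HasDerivAt (fun s : ℝ => Complex.exp (-(s * ℓ w)))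
        (Complex.exp (-(s * ℓ w)) * -(ℓ w)) s := by
      have := ((Complex.ofRealCLM.hasDerivAt (x := s)).mul_const (ℓ w)).neg
      simpa using this.cexp
    exact ((hline' s).mul h3).congr_deriv (by ring)
  have hc := is_const_of_deriv_eq_zero (fun s => (hk s).differentiableAt)
    (fun s => (hk s).deriv) 1 0
  simp only [one_smul, zero_smul, h0, Complex.ofReal_one, one_mul, Complex.ofReal_zero, zero_mul,
    neg_zero, Complex.exp_zero, Complex.exp_neg] at hc
  exact (mul_inv_eq_one₀ (Complex.exp_ne_zero _)).1 hc

/-- The endomorphism of the torus whose coordinates are given characters. -/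
def torusHom (χ : Fin n → SmoothCharacter n) : CTorus n →* CTorus n where
  toFun g := ofCoords fun i => (χ i).toHom g
  map_one' := ext_coord fun i => by simp [coord_ofCoords]
  map_mul' g h := ext_coord fun i => by simp [coord_ofCoords]

theorem coord_torusHom (χ : Fin n → SmoothCharacter n) (g : CTorus n) (i : Fin n) :
    coord i (torusHom χ g) = (χ i).toHom g := coord_ofCoords _ _

theorem coe_torusHom (χ : Fin n → SmoothCharacter n) (g : CTorus n) (i : Fin n) :
    (torusHom χ g : Fin n → ℂ) i = (χ i).toHom g := by
  rw [← coe_coord, coord_torusHom]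

theorem contMDiff_torusHom (χ : Fin n → SmoothCharacter n) :
    ContMDiff 𝓘(ℝ, Fin n → ℂ) 𝓘(ℝ, Fin n → ℂ) ∞ (torusHom χ) := by
  apply ContMDiff.of_comp_isOpenEmbedding Units.isOpenEmbedding_val
  refine contMDiff_pi_space.2 fun i => ?_
  exact ((Units.contMDiff_val (R := ℂ) (𝕜 := ℝ)).comp (χ i).smooth).congr
    fun g => coe_torusHom χ g i

/-- An injective family of characters is a real-linear automorphism in logarithmic coordinates. -/
theorem exists_logEquiv {χ : Fin n → SmoothCharacter n} (hχ : Function.Injective (torusHom χ)) :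
    ∃ L : (Fin n → ℂ) ≃L[ℝ] (Fin n → ℂ), ∀ w, torusHom χ (exp w) = exp (L w) := by
  choose ℓ hℓ using fun i => (χ i).exists_log
  let A : (Fin n → ℂ) →L[ℝ] (Fin n → ℂ) := ContinuousLinearMap.pi ℓ
  have hA : ∀ w, torusHom χ (exp w) = exp (A w) := fun w => ext_coe fun i => by
    rw [coe_torusHom, hℓ]
    rfl
  have hinj : Function.Injective A := by
    refine (injective_iff_map_eq_zero A).2 fun w hw => eq_zero_of_exp_smul_eq_one fun s => hχ ?_
    rw [hA, map_smul, hw, smul_zero, exp_zero, map_one]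
  let e := LinearEquiv.ofInjectiveEndo (A : (Fin n → ℂ) →ₗ[ℝ] (Fin n → ℂ)) hinj
  exact ⟨e.toContinuousLinearEquiv, fun w => by rw [hA]; rfl⟩

theorem torusHom_bijective {χ : Fin n → SmoothCharacter n}
    (hχ : Function.Injective (torusHom χ)) : Function.Bijective (torusHom χ) := by
  obtain ⟨L, hL⟩ := exists_logEquiv hχ
  refine ⟨hχ, fun g => ?_⟩
  obtain ⟨w, rfl⟩ := exp_surjective g
  exact ⟨exp (L.symm w), by rw [hL, L.apply_symm_apply]⟩

/-- The inverse of a bijective `torusHom` is smooth, since near a point `t₀` it is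
`t ↦ χ⁻¹(t₀) * exp (L⁻¹ (log (t / t₀)))`. -/
theorem contMDiff_torusHom_symm {χ : Fin n → SmoothCharacter n}
    (hχ : Function.Injective (torusHom χ)) :
    ContMDiff 𝓘(ℝ, Fin n → ℂ) 𝓘(ℝ, Fin n → ℂ) ∞
      (Equiv.ofBijective _ (torusHom_bijective hχ)).symm := by
  obtain ⟨L, hL⟩ := exists_logEquiv hχ
  intro t₀
  set e := Equiv.ofBijective _ (torusHom_bijective hχ)
  have he : ∀ g, e g = torusHom χ g := fun _ => rfl
  let lg : CTorus n → (Fin n → ℂ) := fun t i =>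
    Complex.log ((t : Fin n → ℂ) i / (t₀ : Fin n → ℂ) i)
  have hlg : ContMDiffAt 𝓘(ℝ, Fin n → ℂ) 𝓘(ℝ, Fin n → ℂ) ∞ lg t₀ := by
    refine contMDiffAt_pi_space.2 fun i => ?_
    have h1 : ContDiffAt ℝ ∞ (fun z : Fin n → ℂ => Complex.log (z i / (t₀ : Fin n → ℂ) i))
        (t₀ : Fin n → ℂ) := by
      have h2 : ContDiffAt ℝ ∞ (fun z : Fin n → ℂ => z i / (t₀ : Fin n → ℂ) i)
          (t₀ : Fin n → ℂ) := (contDiff_apply ℝ ℂ i).contDiffAt.div_const _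
      have h3 : ContDiffAt ℝ ∞ Complex.log
          ((t₀ : Fin n → ℂ) i / (t₀ : Fin n → ℂ) i) := by
        rw [div_self (coe_ne_zero t₀ i)]
        exact (Complex.contDiffAt_log (Complex.one_mem_slitPlane)).restrict_scalars ℝ
      exact ContDiffAt.comp (g := Complex.log) _ h3 h2
    exact (contMDiffAt_iff_contDiffAt.2 h1).comp t₀ (Units.contMDiff_val (R := Fin n → ℂ) t₀)
  have hexp : ∀ t, exp (lg t) = t * t₀⁻¹ := by
    intro t
    rw [eq_mul_inv_iff_mul_eq]
    refine ext_coe fun i => ?_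
    have h1 := coe_ne_zero t i
    have h2 := coe_ne_zero t₀ i
    simp only [Units.val_mul, Pi.mul_apply, coe_exp, lg]
    rw [Complex.exp_log (div_ne_zero h1 h2), div_mul_cancel₀ _ h2]
  have hsymm : ∀ t, e.symm t = e.symm t₀ * exp (L.symm (lg t)) := by
    intro t
    rw [Equiv.symm_apply_eq, he, map_mul, ← he, e.apply_symm_apply, hL, L.apply_symm_apply, hexp,
      mul_comm, inv_mul_cancel_right]
  have h4 : ContMDiffAt 𝓘(ℝ, Fin n → ℂ) 𝓘(ℝ, Fin n → ℂ) ∞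
      (fun t => exp (L.symm (lg t))) t₀ :=
    (contMDiff_exp _).comp t₀ ((L.symm.contDiff.contMDiff _).comp t₀ hlg)
  have h5 : ContMDiffAt 𝓘(ℝ, Fin n → ℂ) 𝓘(ℝ, Fin n → ℂ) ∞
      (fun t => e.symm t₀ * exp (L.symm (lg t))) t₀ := contMDiffAt_const.mul h4
  exact h5.congr_of_eventuallyEq (Filter.Eventually.of_forall hsymm)

end SmoothCharacter

/-- A family of real-linear endomorphisms `A z` of `ℂ^n` that is continuous, invariant under
coordinatewise multiplication by units and squares to `-1` is the multiplication by a constant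
vector with entries `±√-1`: invariance under real homotheties makes it constant, and a constant
one commutes with all diagonal matrices. -/
theorem exists_eps_of_invariant {n : ℕ} (A : (Fin n → ℂ) → (Fin n → ℂ) →ₗ[ℝ] (Fin n → ℂ))
    (hcont : ∀ v, Continuous fun z => A z v)
    (hinv : ∀ (t : CTorus n) z v, A ((t : Fin n → ℂ) * z) ((t : Fin n → ℂ) * v)
      = (t : Fin n → ℂ) * A z v)
    (hsq : ∀ z v, A z (A z v) = -v) :
    ∃ ε : Fin n → ℂ, (∀ i, ε i = Complex.I ∨ ε i = -Complex.I) ∧ ∀ z v, A z v = ε * v := by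
  have hconst : ∀ z v, A z v = A 0 v := by
    intro z v
    have hscale : ∀ s : ℝ, s ≠ 0 → A (s • z) v = A z v := by
      intro s hs
      have hs' : (s : ℂ) ≠ 0 := by exact_mod_cast hs
      have key : ∀ u : Fin n → ℂ,
          ((CTorus.ofCoords fun _ => Units.mk0 (s : ℂ) hs' : CTorus n) : Fin n → ℂ) * u
            = s • u := by
        intro u
        funext i
        rw [Pi.mul_apply, ← CTorus.coe_coord, CTorus.coord_ofCoords]
        simp
      have h := hinv (CTorus.ofCoords fun _ => Units.mk0 (s : ℂ) hs') z v
      rw [key, key, key, map_smul] at h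
      exact smul_right_injective _ hs h
    have hlim : Filter.Tendsto (fun s : ℝ => A (s • z) v) (nhdsWithin 0 {0}ᶜ) (nhds (A 0 v)) := by
      have hc : Continuous fun s : ℝ => A (s • z) v :=
        (hcont v).comp (continuous_id.smul continuous_const)
      have := hc.tendsto 0
      rw [zero_smul] at this
      exact this.mono_left nhdsWithin_le_nhds
    refine tendsto_nhds_unique (Filter.Tendsto.congr' ?_ tendsto_const_nhds) hlim
    filter_upwards [self_mem_nhdsWithin] with s hs
    exact (hscale s hs).symm
  have hmul : ∀ (t : CTorus n) v, A 0 ((t : Fin n → ℂ) * v) = (t : Fin n → ℂ) * A 0 v := by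
    intro t v
    rw [← hinv, mul_zero]
  -- every vector is a sum of two vectors without zero entries
  have hA : ∀ v, A 0 v = A 0 1 * v := by
    intro v
    obtain ⟨c, hc⟩ : ∃ c : ℝ, ∀ i, v i + c ≠ 0 ∧ (c : ℂ) ≠ 0 := by
      obtain ⟨c, hc⟩ := Set.Infinite.exists_notMem_finset (Set.infinite_univ (α := ℝ))
        (insert 0 (Finset.univ.image fun i => -(v i).re))
      refine ⟨c, fun i => ⟨fun h => hc.2 ?_, fun h => hc.2 ?_⟩⟩
      · refine Finset.mem_insert_of_mem (Finset.mem_image.2 ⟨i, Finset.mem_univ _, ?_⟩)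
        have := congrArg Complex.re h
        simp at this
        linarith
      · rw [Complex.ofReal_eq_zero.1 h]
        exact Finset.mem_insert_self _ _
    let t₁ : CTorus n := CTorus.ofCoords fun i => Units.mk0 (v i + c) (hc i).1
    let t₂ : CTorus n := CTorus.ofCoords fun i => Units.mk0 (c : ℂ) (hc i).2
    have ht : v = (t₁ : Fin n → ℂ) * 1 - (t₂ : Fin n → ℂ) * 1 := by
      funext i
      change v i = (v i + c) * 1 - c * 1
      ring
    conv_lhs => rw [ht]
    rw [map_sub, hmul, hmul, ← sub_mul, mul_comm]
    congr 1
    conv_rhs => rw [ht]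
    rw [mul_one, mul_one]
  refine ⟨A 0 1, fun i => ?_, fun z v => by rw [hconst, hA]⟩
  have h := congrFun (hsq 0 1) i
  rw [hA (A 0 1)] at h
  simp only [Pi.mul_apply, Pi.neg_apply, Pi.one_apply] at h
  rw [← Complex.I_mul_I] at h
  exact mul_self_eq_mul_self_iff.1 h

/-! ### Equivariant charts -/

namespace EquivariantChart

open SmoothCharacter Set

variable {n : ℕ} {X : Type*} [TopologicalSpace X]
  [ChartedSpace (EuclideanSpace ℝ (Fin (2 * n))) X] [MulAction (CTorus n) X]
  (φ : EquivariantChart n X)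

theorem mem_target (z : Fin n → ℂ) : z ∈ φ.target := by rw [φ.target_eq]; trivial

theorem symm_mem (z : Fin n → ℂ) : φ.symm z ∈ φ.source := φ.map_target (φ.mem_target z)

theorem apply_symm (z : Fin n → ℂ) : φ.toOpenPartialHomeomorph (φ.symm z) = z :=
  φ.right_inv (φ.mem_target z)

theorem continuous_symm : Continuous φ.symm := by
  have := φ.continuousOn_symm
  rwa [φ.target_eq, continuousOn_univ] at this

theorem apply_smul (g : CTorus n) {x : X} (hx : x ∈ φ.source) :
    φ.toOpenPartialHomeomorph (g • x)
      = (torusHom φ.weight g : Fin n → ℂ) * φ.toOpenPartialHomeomorph x := by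
  funext i
  rw [φ.equivariant g x hx i, Pi.mul_apply, coe_torusHom]

theorem contMDiffAt {x : X} (hx : x ∈ φ.source) :
    ContMDiffAt (𝓡 (2 * n)) 𝓘(ℝ, Fin n → ℂ) ∞ φ.toOpenPartialHomeomorph x :=
  (φ.smooth x hx).contMDiffAt (φ.open_source.mem_nhds hx)

theorem contMDiffAt_symm (z : Fin n → ℂ) :
    ContMDiffAt 𝓘(ℝ, Fin n → ℂ) (𝓡 (2 * n)) ∞ φ.symm z :=
  (φ.smooth_symm z (φ.mem_target z)).contMDiffAt (φ.open_target.mem_nhds (φ.mem_target z))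

theorem mdifferentiableAt {x : X} (hx : x ∈ φ.source) :
    MDifferentiableAt (𝓡 (2 * n)) 𝓘(ℝ, Fin n → ℂ) φ.toOpenPartialHomeomorph x :=
  (φ.contMDiffAt hx).mdifferentiableAt (by simp)

theorem mdifferentiableAt_symm (z : Fin n → ℂ) :
    MDifferentiableAt 𝓘(ℝ, Fin n → ℂ) (𝓡 (2 * n)) φ.symm z :=
  (φ.contMDiffAt_symm z).mdifferentiableAt (by simp)

/-- The differential of an equivariant chart. -/
def diff (x : X) : TangentSpace (𝓡 (2 * n)) x →L[ℝ] (Fin n → ℂ) :=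
  mfderiv (𝓡 (2 * n)) 𝓘(ℝ, Fin n → ℂ) φ.toOpenPartialHomeomorph x

/-- The differential of the inverse of an equivariant chart. -/
def diffSymm (z : Fin n → ℂ) : (Fin n → ℂ) →L[ℝ] TangentSpace (𝓡 (2 * n)) (φ.symm z) :=
  mfderiv 𝓘(ℝ, Fin n → ℂ) (𝓡 (2 * n)) φ.symm z

theorem diff_diffSymm (z v : Fin n → ℂ) : φ.diff (φ.symm z) (φ.diffSymm z v) = v := by
  have h := mfderiv_comp z (φ.mdifferentiableAt (φ.symm_mem z)) (φ.mdifferentiableAt_symm z)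
  have h' : φ.toOpenPartialHomeomorph ∘ φ.symm = id := funext φ.apply_symm
  rw [h', mfderiv_id] at h
  exact (congrArg (fun A => A v) h).symm

theorem diffSymm_diff (z : Fin n → ℂ) (v : TangentSpace (𝓡 (2 * n)) (φ.symm z)) :
    φ.diffSymm z (φ.diff (φ.symm z) v) = v := by
  have hd : MDifferentiableAt 𝓘(ℝ, Fin n → ℂ) (𝓡 (2 * n)) φ.symm
      (φ.toOpenPartialHomeomorph (φ.symm z)) := φ.mdifferentiableAt_symm _
  have h := mfderiv_comp (φ.symm z) hd (φ.mdifferentiableAt (φ.symm_mem z))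
  have h' : (φ.symm ∘ φ.toOpenPartialHomeomorph) =ᶠ[nhds (φ.symm z)] id := by
    filter_upwards [φ.open_source.mem_nhds (φ.symm_mem z)] with x hx
    exact φ.left_inv hx
  rw [h'.mfderiv_eq, mfderiv_id] at h
  have h2 : ∀ w, w = φ.toOpenPartialHomeomorph (φ.symm z) →
      (mfderiv 𝓘(ℝ, Fin n → ℂ) (𝓡 (2 * n)) φ.symm w :
        (Fin n → ℂ) →L[ℝ] EuclideanSpace ℝ (Fin (2 * n))) (φ.diff (φ.symm z) v) = v := by
    rintro w rfl
    exact (congrArg (fun A => A v) h).symm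
  exact h2 z (φ.apply_symm z).symm

section action

variable [IsManifold (𝓡 (2 * n)) ∞ X] (hX : IsTopologicalToricManifold n X)

include hX

theorem exists_orbit_subset_source : ∃ x : X, IsOpen (MulAction.orbit (CTorus n) x) ∧
    Dense (MulAction.orbit (CTorus n) x) ∧ ∀ φ : EquivariantChart n X,
      MulAction.orbit (CTorus n) x ⊆ φ.source := by
  obtain ⟨x, ho, hd⟩ := hX.exists_orbit
  refine ⟨x, ho, hd, fun φ => ?_⟩
  obtain ⟨y, hy, g, rfl⟩ := hd.inter_open_nonempty _ φ.open_source ⟨_, φ.symm_mem 0⟩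
  rintro _ ⟨h, rfl⟩
  have := φ.smul_mem (h * g⁻¹) _ hy
  simpa [mul_smul] using this

theorem dense_source : Dense φ.source := by
  obtain ⟨x, _, hd, hs⟩ := exists_orbit_subset_source hX
  exact hd.mono (hs φ)

theorem continuous_smul (g : CTorus n) : Continuous fun x : X => g • x :=
  hX.smooth_smul.continuous.comp (continuous_const.prodMk continuous_id)

theorem torusHom_injective : Function.Injective (torusHom φ.weight) := by
  have := hX.t2Space
  refine (injective_iff_map_eq_one _).2 fun g hg => hX.effective g ?_
  have h : (fun x : X => g • x) = id := by
    refine Continuous.ext_on (φ.dense_source hX) (continuous_smul hX g) continuous_id fun x hx => ?_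
    refine φ.injOn (φ.smul_mem g x hx) hx ?_
    rw [φ.apply_smul g hx, hg]
    simp
  exact fun x => congrFun h x

theorem torusHom_bijective : Function.Bijective (torusHom φ.weight) :=
  SmoothCharacter.torusHom_bijective (φ.torusHom_injective hX)

/-- Every equivariant chart identifies the open orbit with `(ℂ^*)^n`. -/
theorem mem_orbit_iff {x : X} (ho : Dense (MulAction.orbit (CTorus n) x))
    (hs : MulAction.orbit (CTorus n) x ⊆ φ.source) (y : X) (hy : y ∈ φ.source) :
    y ∈ MulAction.orbit (CTorus n) x ↔ ∀ i, φ.toOpenPartialHomeomorph y i ≠ 0 := by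
  have hx : x ∈ φ.source := hs (MulAction.mem_orbit_self x)
  -- the set of points with non-vanishing coordinates is a single orbit
  have key : ∀ y z, y ∈ φ.source → z ∈ φ.source → (∀ i, φ.toOpenPartialHomeomorph y i ≠ 0) →
      (∀ i, φ.toOpenPartialHomeomorph z i ≠ 0) → ∃ g : CTorus n, g • y = z := by
    intro y z hy hz hy0 hz0
    obtain ⟨g, hg⟩ := (φ.torusHom_bijective hX).2 (CTorus.ofCoords fun i =>
      Units.mk0 (φ.toOpenPartialHomeomorph z i / φ.toOpenPartialHomeomorph y i)
        (div_ne_zero (hz0 i) (hy0 i)))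
    refine ⟨g, φ.injOn (φ.smul_mem g y hy) hz ?_⟩
    rw [φ.apply_smul g hy, hg]
    funext i
    exact div_mul_cancel₀ _ (hy0 i)
  have hopen : IsOpen (φ.source ∩ φ.toOpenPartialHomeomorph ⁻¹' {z | ∀ i, z i ≠ 0}) := by
    refine φ.toOpenPartialHomeomorph.isOpen_inter_preimage ?_
    rw [ofPred_forall]
    exact isOpen_iInter_of_finite fun i => isOpen_ne_fun (continuous_apply i) continuous_const
  obtain ⟨y₀, hy₀, ⟨g, rfl⟩⟩ := ho.inter_open_nonempty _ hopen
    ⟨φ.symm 1, φ.symm_mem 1, by simp [φ.apply_symm]⟩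
  have hx0 : ∀ i, φ.toOpenPartialHomeomorph x i ≠ 0 := by
    intro i hi
    refine hy₀.2 i ?_
    change φ.toOpenPartialHomeomorph (g • x) i = 0
    rw [φ.equivariant g x hx i, hi, mul_zero]
  constructor
  · rintro ⟨g, rfl⟩ i
    change φ.toOpenPartialHomeomorph (g • x) i ≠ 0
    rw [φ.equivariant g x hx i]
    exact mul_ne_zero (Units.ne_zero _) (hx0 i)
  · intro hy0
    exact key x y hx hy hx0 hy0

theorem mdifferentiable_smul (g : CTorus n) :
    MDifferentiable (𝓡 (2 * n)) (𝓡 (2 * n)) fun x : X => g • x := by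
  have h1 : ContMDiff (𝓡 (2 * n)) (𝓘(ℝ, Fin n → ℂ).prod (𝓡 (2 * n))) ∞
      (fun x : X => ((g, x) : CTorus n × X)) := contMDiff_const.prodMk contMDiff_id
  exact (hX.smooth_smul.comp h1).mdifferentiable (by simp)

theorem diff_smul (g : CTorus n) {x : X} (hx : x ∈ φ.source) (v : TangentSpace (𝓡 (2 * n)) x) :
    φ.diff (g • x) (mfderiv (𝓡 (2 * n)) (𝓡 (2 * n)) (fun y : X => g • y) x v)
      = (torusHom φ.weight g : Fin n → ℂ) * φ.diff x v := by
  set c : Fin n → ℂ := (torusHom φ.weight g : Fin n → ℂ)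
  have h1 := mfderiv_comp x (φ.mdifferentiableAt (φ.smul_mem g x hx))
    (mdifferentiable_smul hX g x)
  have hm : MDifferentiableAt 𝓘(ℝ, Fin n → ℂ) 𝓘(ℝ, Fin n → ℂ)
      (ContinuousLinearMap.mul ℝ (Fin n → ℂ) c) (φ.toOpenPartialHomeomorph x) :=
    (ContinuousLinearMap.mul ℝ (Fin n → ℂ) c).mdifferentiableAt
  have h2 := mfderiv_comp x hm (φ.mdifferentiableAt hx)
  have h3 : (φ.toOpenPartialHomeomorph ∘ fun y : X => g • y) =ᶠ[nhds x]
      (ContinuousLinearMap.mul ℝ (Fin n → ℂ) c) ∘ φ.toOpenPartialHomeomorph := by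
    filter_upwards [φ.open_source.mem_nhds hx] with y hy
    exact φ.apply_smul g hy
  rw [h3.mfderiv_eq, h2] at h1
  have h4 := congrArg (fun A => A v) h1
  rw [ContinuousLinearMap.mfderiv_eq] at h4
  exact h4.symm

end action

section almostComplex

variable [IsManifold (𝓡 (2 * n)) ∞ X] (J : AlmostComplexStructure n X)

/-- The expression of an almost complex structure in an equivariant chart. -/
def transport (z : Fin n → ℂ) : (Fin n → ℂ) →ₗ[ℝ] (Fin n → ℂ) :=
  (φ.diff (φ.symm z)).toLinearMap ∘ₗ (J.toFun (φ.symm z)).toLinearMap ∘ₗ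
    (φ.diffSymm z).toLinearMap

theorem transport_apply (z v : Fin n → ℂ) :
    φ.transport J z v = φ.diff (φ.symm z) (J.toFun (φ.symm z) (φ.diffSymm z v)) := rfl

theorem continuous_transport (v : Fin n → ℂ) : Continuous fun z => φ.transport J z v := by
  have h1 : Continuous fun z : Fin n → ℂ =>
      (⟨z, v⟩ : TangentBundle 𝓘(ℝ, Fin n → ℂ) (Fin n → ℂ)) :=
    (tangentBundleModelSpaceHomeomorph 𝓘(ℝ, Fin n → ℂ)).symm.continuous.comp
      (continuous_id.prodMk continuous_const)
  have hsymm : ContMDiff 𝓘(ℝ, Fin n → ℂ) (𝓡 (2 * n)) ∞ φ.symm := φ.contMDiffAt_symm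
  have h2 := J.smooth.continuous.comp ((hsymm.continuous_tangentMap (by simp)).comp h1)
  have h3 := φ.smooth.continuousOn_tangentMapWithin (by simp) φ.open_source.uniqueMDiffOn
  have h4 := h3.comp_continuous h2 (fun z => φ.symm_mem z)
  have h5 := (tangentBundleModelSpaceHomeomorph 𝓘(ℝ, Fin n → ℂ)).continuous.comp h4
  refine (continuous_snd.comp h5).congr fun z => ?_
  change mfderivWithin (𝓡 (2 * n)) 𝓘(ℝ, Fin n → ℂ) φ.toOpenPartialHomeomorph φ.source (φ.symm z)
    (J.toFun (φ.symm z) (φ.diffSymm z v)) = _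
  rw [mfderivWithin_of_mem_nhds (φ.open_source.mem_nhds (φ.symm_mem z))]
  rfl

variable (hX : IsTopologicalToricManifold n X) {J} (hJ : J.IsInvariant)

include hX hJ

/-- In an equivariant chart, an invariant almost complex structure is the multiplication by
`±√-1` on each coordinate. -/
theorem exists_eps : ∃ ε : Fin n → ℂ, (∀ i, ε i = Complex.I ∨ ε i = -Complex.I) ∧
    ∀ x ∈ φ.source, ∀ v, φ.diff x (J.toFun x v) = ε * φ.diff x v := by
  suffices hA : (∀ (t : CTorus n) z v, φ.transport J ((t : Fin n → ℂ) * z) ((t : Fin n → ℂ) * v)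
      = (t : Fin n → ℂ) * φ.transport J z v) ∧
      ∀ z v, φ.transport J z (φ.transport J z v) = -v by
    obtain ⟨ε, hε, h⟩ := exists_eps_of_invariant (φ.transport J) (φ.continuous_transport J)
      hA.1 hA.2
    refine ⟨ε, hε, fun x hx v => ?_⟩
    obtain ⟨z, rfl⟩ : ∃ z, φ.symm z = x := ⟨_, φ.left_inv hx⟩
    rw [← h z, transport_apply, diffSymm_diff]
  constructor
  · intro t z v
    obtain ⟨g, rfl⟩ := (φ.torusHom_bijective hX).2 t
    have hgz : φ.symm ((torusHom φ.weight g : Fin n → ℂ) * z) = g • φ.symm z := by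
      refine φ.injOn (φ.symm_mem _) (φ.smul_mem g _ (φ.symm_mem z)) ?_
      rw [φ.apply_smul g (φ.symm_mem z), apply_symm, apply_symm]
    have hd : ∀ (y : X) (hy : y = g • φ.symm z) (u : TangentSpace (𝓡 (2 * n)) y),
        φ.diff y u = (torusHom φ.weight g : Fin n → ℂ) * v →
        φ.diff y (J.toFun y u) = (torusHom φ.weight g : Fin n → ℂ) * φ.transport J z v := by
      rintro y rfl u hu
      have hu' : u = mfderiv (𝓡 (2 * n)) (𝓡 (2 * n)) (fun y : X => g • y) (φ.symm z)
          (φ.diffSymm z v) := by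
        have hinj : Function.Injective (φ.diff (g • φ.symm z)) := by
          have : ∀ (y : X), y ∈ φ.source → Function.Injective (φ.diff y) := by
            intro y hy
            obtain ⟨w, rfl⟩ : ∃ w, φ.symm w = y := ⟨_, φ.left_inv hy⟩
            exact Function.LeftInverse.injective (φ.diffSymm_diff w)
          exact this _ (φ.smul_mem g _ (φ.symm_mem z))
        apply hinj
        rw [hu, φ.diff_smul hX g (φ.symm_mem z), diff_diffSymm]
      rw [hu', ← hJ, φ.diff_smul hX g (φ.symm_mem z), transport_apply]
    exact hd _ hgz _ (φ.diff_diffSymm _ _)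
  · intro z v
    rw [transport_apply, transport_apply, diffSymm_diff, J.sq, map_neg, diff_diffSymm]

end almostComplex

end EquivariantChart

/-! ### Compatible charts and their transition monomials -/

/-- The complex conjugate of a smooth character. -/
def SmoothCharacter.conj {n : ℕ} (χ : SmoothCharacter n) : SmoothCharacter n where
  toHom := (Units.map (starRingEnd ℂ : ℂ →* ℂ)).comp χ.toHom
  smooth := by
    apply ContMDiff.of_comp_isOpenEmbedding Units.isOpenEmbedding_val
    exact (Complex.conjCLE.contDiff.contMDiff).comp
      ((Units.contMDiff_val (R := ℂ) (𝕜 := ℝ)).comp χ.smooth)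

namespace EquivariantChart

open SmoothCharacter Set

variable {n : ℕ} {X : Type*} [TopologicalSpace X]
  [ChartedSpace (EuclideanSpace ℝ (Fin (2 * n))) X] [MulAction (CTorus n) X]
  (φ : EquivariantChart n X)

/-- The equivariant chart obtained by composing with a linear automorphism of `ℂ^n` that
intertwines two actions of the torus by characters. -/
def postcomp (L : (Fin n → ℂ) ≃L[ℝ] (Fin n → ℂ)) (χ : Fin n → SmoothCharacter n)
    (h : ∀ (g : CTorus n) (z : Fin n → ℂ) (i : Fin n),
      L ((torusHom φ.weight g : Fin n → ℂ) * z) i = ((χ i).toHom g : ℂ) * L z i) :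
    EquivariantChart n X where
  toOpenPartialHomeomorph := φ.toOpenPartialHomeomorph.transHomeomorph L.toHomeomorph
  weight := χ
  target_eq := by simp [OpenPartialHomeomorph.transHomeomorph, φ.target_eq]
  smul_mem := φ.smul_mem
  smooth := L.contDiff.contMDiff.comp_contMDiffOn φ.smooth
  smooth_symm := by
    refine φ.smooth_symm.comp (L.symm.contDiff.contMDiff.contMDiffOn) fun z _ => ?_
    exact φ.mem_target _
  equivariant g x hx i := by
    change L (φ.toOpenPartialHomeomorph (g • x)) i = _
    rw [φ.apply_smul g hx, h]
    rfl

section postcomp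

variable (L : (Fin n → ℂ) ≃L[ℝ] (Fin n → ℂ)) (χ : Fin n → SmoothCharacter n)
    (h : ∀ (g : CTorus n) (z : Fin n → ℂ) (i : Fin n),
      L ((torusHom φ.weight g : Fin n → ℂ) * z) i = ((χ i).toHom g : ℂ) * L z i)

theorem postcomp_source : (φ.postcomp L χ h).source = φ.source := rfl

theorem postcomp_apply (x : X) :
    (φ.postcomp L χ h).toOpenPartialHomeomorph x = L (φ.toOpenPartialHomeomorph x) := rfl

theorem postcomp_diff {x : X} (hx : x ∈ φ.source) (v : TangentSpace (𝓡 (2 * n)) x) :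
    (φ.postcomp L χ h).diff x v = L (φ.diff x v) := by
  have h1 : MDifferentiableAt 𝓘(ℝ, Fin n → ℂ) 𝓘(ℝ, Fin n → ℂ)
      (L : (Fin n → ℂ) →L[ℝ] (Fin n → ℂ)) (φ.toOpenPartialHomeomorph x) :=
    ContinuousLinearMap.mdifferentiableAt _
  have h2 := mfderiv_comp x h1 (φ.mdifferentiableAt hx)
  rw [ContinuousLinearMap.mfderiv_eq] at h2
  exact congrArg (fun A => A v) h2

end postcomp

variable [IsManifold (𝓡 (2 * n)) ∞ X] (J : AlmostComplexStructure n X)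

/-- The differential of the chart is complex linear with respect to `J`. -/
def IsJLinear : Prop :=
  ∀ x ∈ φ.source, ∀ v, φ.diff x (J.toFun x v) = Complex.I • φ.diff x v

variable {J} {φ}

theorem IsJLinear.isHolomorphicOn (h : φ.IsJLinear J) :
    J.IsHolomorphicOn φ.toOpenPartialHomeomorph φ.source := ⟨φ.smooth, h⟩

theorem IsJLinear.isCompatible (h : φ.IsJLinear J) : J.IsCompatible φ := by
  intro i x hx _ ξ dφ hξ
  have h1 : dφ (J.toFun x ξ) i = Complex.I * dφ ξ i := congrFun (h x hx ξ) i
  rw [h1, mul_left_comm, ← Complex.normSq_eq_conj_mul_self]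
  simpa using hξ

variable (hX : IsTopologicalToricManifold n X) (hJ : J.IsInvariant)

include hX hJ

/-- Compatibility at the fixed point of a chart determines all the signs of `J` in the chart. -/
theorem isJLinear_of_isCompatible (h : J.IsCompatible φ) : φ.IsJLinear J := by
  obtain ⟨ε, hε, hφ⟩ := φ.exists_eps hX hJ
  have hεI : ∀ i, ε i = Complex.I := by
    intro i
    refine (hε i).resolve_right fun hi => ?_
    have h1 : φ.diff (φ.symm 0) (φ.diffSymm 0 1) = 1 := φ.diff_diffSymm 0 1
    have h2 : φ.diff (φ.symm 0) (J.toFun _ (φ.diffSymm 0 1)) = ε := by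
      rw [hφ _ (φ.symm_mem 0), h1, mul_one]
    have h3 : φ.diff (φ.symm 0) (φ.diffSymm 0 1) i ≠ 0 →
        0 < ((starRingEnd ℂ) (φ.diff (φ.symm 0) (φ.diffSymm 0 1) i) *
          φ.diff (φ.symm 0) (J.toFun _ (φ.diffSymm 0 1)) i).im :=
      h i (φ.symm 0) (φ.symm_mem 0) (by rw [φ.apply_symm]; rfl) (φ.diffSymm 0 1)
    rw [h2, h1, hi] at h3
    norm_num at h3
  intro x hx v
  rw [hφ x hx]
  funext i
  simp [hεI]

variable (φ) in
/-- Conjugating the coordinates in which `J` is the multiplication by `-√-1` makes a chart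
compatible. -/
theorem exists_isJLinear_conj : ∃ ψ : EquivariantChart n X, ψ.source = φ.source ∧ ψ.IsJLinear J ∧
    ∀ i, (∀ x ∈ φ.source,
        ψ.toOpenPartialHomeomorph x i = φ.toOpenPartialHomeomorph x i) ∨
      (∀ x ∈ φ.source, ψ.toOpenPartialHomeomorph x i =
        (starRingEnd ℂ) (φ.toOpenPartialHomeomorph x i)) := by
  classical
  obtain ⟨ε, hε, hφ⟩ := φ.exists_eps hX hJ
  let L : (Fin n → ℂ) ≃L[ℝ] (Fin n → ℂ) := ContinuousLinearEquiv.piCongrRight fun i =>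
    if ε i = Complex.I then ContinuousLinearEquiv.refl ℝ ℂ else Complex.conjCLE
  have hL1 : ∀ z i, ε i = Complex.I → L z i = z i := fun z i hi => by simp [L, hi]
  have hL2 : ∀ z i, ε i ≠ Complex.I → L z i = (starRingEnd ℂ) (z i) := fun z i hi => by simp [L, hi]
  let ψ := φ.postcomp L (fun i => if ε i = Complex.I then φ.weight i else (φ.weight i).conj) (by
    intro g z i
    by_cases hi : ε i = Complex.I
    · rw [hL1 _ _ hi, hL1 _ _ hi, if_pos hi, Pi.mul_apply, coe_torusHom]
    · rw [hL2 _ _ hi, hL2 _ _ hi, if_neg hi, Pi.mul_apply, coe_torusHom, map_mul]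
      rfl)
  refine ⟨ψ, rfl, fun x hx v => ?_, fun i => ?_⟩
  · rw [φ.postcomp_diff L _ _ hx, φ.postcomp_diff L _ _ hx, hφ x hx]
    funext i
    by_cases hi : ε i = Complex.I
    · rw [Pi.smul_apply, hL1 _ _ hi, hL1 _ _ hi, Pi.mul_apply, hi, smul_eq_mul]
    · rw [Pi.smul_apply, hL2 _ _ hi, hL2 _ _ hi, Pi.mul_apply, (hε i).resolve_left hi, smul_eq_mul]
      simp
  · by_cases hi : ε i = Complex.I
    · exact Or.inl fun x _ => hL1 _ _ hi
    · exact Or.inr fun x _ => hL2 _ _ hi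

omit hX hJ

variable (φ) in
/-- A holomorphic equivariant chart normalized to take the value `(1, …, 1)` at a base point. -/
structure IsAdapted (J : AlmostComplexStructure n X) (x₀ : X) : Prop where
  isJLinear : φ.IsJLinear J
  base_mem : x₀ ∈ φ.source
  apply_base : φ.toOpenPartialHomeomorph x₀ = 1

include hX hJ

theorem exists_isAdapted {x₀ : X} (ho : Dense (MulAction.orbit (CTorus n) x₀))
    (hs : ∀ φ : EquivariantChart n X, MulAction.orbit (CTorus n) x₀ ⊆ φ.source) (x : X) :
    ∃ φ : EquivariantChart n X, φ.IsAdapted J x₀ ∧ x ∈ φ.source := by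
  obtain ⟨φ, hx⟩ := hX.exists_chart x
  obtain ⟨ψ, hψ, hψJ, -⟩ := exists_isJLinear_conj φ hX hJ
  have h0 : x₀ ∈ ψ.source := hs ψ (MulAction.mem_orbit_self x₀)
  have hne := (ψ.mem_orbit_iff hX ho (hs ψ) x₀ h0).1 (MulAction.mem_orbit_self x₀)
  let L : (Fin n → ℂ) ≃L[ℝ] (Fin n → ℂ) := ContinuousLinearEquiv.piCongrRight fun i =>
    (ContinuousLinearEquiv.unitsEquivAut ℂ (Units.mk0 _ (hne i))⁻¹).restrictScalars ℝ
  have hL : ∀ z i, L z i = z i * (ψ.toOpenPartialHomeomorph x₀ i)⁻¹ := fun z i => by simp [L]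
  refine ⟨ψ.postcomp L ψ.weight fun g z i => ?_, ⟨fun y hy v => ?_, h0, ?_⟩, ?_⟩
  · rw [hL, hL, Pi.mul_apply, coe_torusHom, mul_assoc]
  · rw [ψ.postcomp_diff L _ _ hy, ψ.postcomp_diff L _ _ hy, hψJ y hy]
    funext i
    rw [Pi.smul_apply, hL, hL, Pi.smul_apply, smul_eq_mul, smul_eq_mul, mul_assoc]
  · rw [postcomp_apply]
    funext i
    rw [hL, mul_inv_cancel₀ (hne i), Pi.one_apply]
  · rw [postcomp_source, hψ]
    exact hx

omit hX hJ

theorem IsAdapted.apply_smul_base {x₀ : X} (h : φ.IsAdapted J x₀) (g : CTorus n) :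
    φ.toOpenPartialHomeomorph (g • x₀) = (torusHom φ.weight g : Fin n → ℂ) := by
  rw [φ.apply_smul g h.base_mem, h.apply_base, mul_one]

include hX

/-- The characters of one adapted chart are Laurent monomials in those of another: in logarithmic
coordinates the transition map is its own differential at the base point, which is complex linear
because both charts are holomorphic, and integral because it preserves the kernel of the
exponential map. -/
theorem IsAdapted.exists_matrix {ψ : EquivariantChart n X} {x₀ : X}
    (hφ : φ.IsAdapted J x₀) (hψ : ψ.IsAdapted J x₀) :
    ∃ M : Matrix (Fin n) (Fin n) ℤ, ∀ g j,
      (torusHom ψ.weight g : Fin n → ℂ) j = ∏ l, (torusHom φ.weight g : Fin n → ℂ) l ^ M j l := by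
  obtain ⟨Lφ, hLφ⟩ := exists_logEquiv (φ.torusHom_injective hX)
  obtain ⟨Lψ, hLψ⟩ := exists_logEquiv (ψ.torusHom_injective hX)
  let A : (Fin n → ℂ) →L[ℝ] (Fin n → ℂ) := (Lψ : (Fin n → ℂ) →L[ℝ] (Fin n → ℂ)) ∘L
    (Lφ.symm : (Fin n → ℂ) →L[ℝ] (Fin n → ℂ))
  have hA : ∀ u, CTorus.exp (A u) = torusHom ψ.weight (CTorus.exp (Lφ.symm u)) := fun u => by
    rw [hLψ]; rfl
  have hsymm : φ.symm 1 = x₀ := by rw [← hφ.apply_base, φ.left_inv hφ.base_mem]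
  have hmem : φ.symm 1 ∈ ψ.source := hsymm ▸ hψ.base_mem
  -- the transition map in logarithmic coordinates
  have htrans : ∀ u, ψ.toOpenPartialHomeomorph (φ.symm (CTorus.exp u : Fin n → ℂ))
      = (CTorus.exp (A u) : Fin n → ℂ) := by
    intro u
    have h1 : φ.symm (CTorus.exp u : Fin n → ℂ) = CTorus.exp (Lφ.symm u) • x₀ := by
      refine φ.injOn (φ.symm_mem _) (φ.smul_mem _ _ hφ.base_mem) ?_
      rw [φ.apply_symm, hφ.apply_smul_base, hLφ, Lφ.apply_symm_apply]
    rw [h1, hψ.apply_smul_base, hA]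
  have hexp : HasFDerivAt (fun u : Fin n → ℂ => (CTorus.exp u : Fin n → ℂ))
      (ContinuousLinearMap.id ℝ (Fin n → ℂ)) 0 := by
    refine hasFDerivAt_pi'.2 fun i => ?_
    have h1 : HasFDerivAt (fun u : Fin n → ℂ => u i)
        (ContinuousLinearMap.proj (R := ℝ) (φ := fun _ : Fin n => ℂ) i) 0 :=
      (ContinuousLinearMap.proj (R := ℝ) (φ := fun _ : Fin n => ℂ) i).hasFDerivAt
    have h2 := h1.cexp
    simp only [Pi.zero_apply, Complex.exp_zero, one_smul] at h2
    exact h2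
  have hdA : ∀ u, A u = ψ.diff (φ.symm 1) (φ.diffSymm 1 u) := by
    have h1 := ((ψ.mdifferentiableAt hmem).hasMFDerivAt.comp (1 : Fin n → ℂ)
      (φ.mdifferentiableAt_symm 1).hasMFDerivAt).hasFDerivAt
    have h2 : HasFDerivAt (ψ.toOpenPartialHomeomorph ∘ φ.symm)
        (ψ.diff (φ.symm 1) ∘L φ.diffSymm 1 : (Fin n → ℂ) →L[ℝ] (Fin n → ℂ))
        ((CTorus.exp (0 : Fin n → ℂ) : CTorus n) : Fin n → ℂ) := by
      rw [CTorus.exp_zero]; exact h1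
    have h3 := h2.comp (0 : Fin n → ℂ) hexp
    have hexp' : HasFDerivAt (fun u : Fin n → ℂ => (CTorus.exp u : Fin n → ℂ))
      (ContinuousLinearMap.id ℝ (Fin n → ℂ)) (A 0) := by rw [map_zero]; exact hexp
    have h4 := hexp'.comp (0 : Fin n → ℂ) A.hasFDerivAt
    have h5 : ((ψ.toOpenPartialHomeomorph ∘ φ.symm) ∘
        fun u : Fin n → ℂ => (CTorus.exp u : Fin n → ℂ)) =
        (fun u : Fin n → ℂ => (CTorus.exp u : Fin n → ℂ)) ∘ A := funext htrans
    rw [h5] at h3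
    have h6 := h4.unique h3
    exact fun u => congrArg (fun B => B u) h6
  have hI : ∀ u, A (Complex.I • u) = Complex.I • A u := by
    intro u
    have h1 : φ.diffSymm 1 (Complex.I • u) = J.toFun _ (φ.diffSymm 1 u) := by
      have h2 := hφ.isJLinear _ (φ.symm_mem 1) (φ.diffSymm 1 u)
      rw [φ.diff_diffSymm] at h2
      rw [← h2, φ.diffSymm_diff]
    rw [hdA, h1, hψ.isJLinear _ hmem, ← hdA]
  have hC : ∀ (c : ℂ) u, A (c • u) = c • A u := by
    intro c u
    have h1 : ∀ v : Fin n → ℂ, c • v = c.re • v + c.im • (Complex.I • v) := by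
      intro v
      funext i
      simp only [Pi.smul_apply, Pi.add_apply, smul_eq_mul, Complex.real_smul]
      conv_lhs => rw [← Complex.re_add_im c]
      ring
    rw [h1, map_add, map_smul, map_smul, hI, ← h1]
  have hper : ∀ l j, ∃ k : ℤ, A (Pi.single l (2 * Real.pi * Complex.I)) j
      = k * (2 * Real.pi * Complex.I) := by
    intro l
    refine CTorus.exp_eq_one_iff.1 ?_
    rw [hA, ← map_one (torusHom ψ.weight)]
    congr 1
    apply φ.torusHom_injective hX
    rw [hLφ, Lφ.apply_symm_apply, map_one, CTorus.exp_eq_one_iff]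
    intro i
    by_cases hi : i = l
    · subst hi; exact ⟨1, by simp⟩
    · exact ⟨0, by simp [hi]⟩
  choose k hk using hper
  have hAk : ∀ u j, A u j = ∑ l, k l j * u l := by
    intro u j
    have h1 : ∀ l, A (Pi.single l (u l)) j = k l j * u l := by
      intro l
      have hpi : (2 * Real.pi * Complex.I : ℂ) ≠ 0 := Complex.two_pi_I_ne_zero
      have h2 : (Pi.single l (u l) : Fin n → ℂ)
          = (u l / (2 * Real.pi * Complex.I)) • Pi.single l (2 * Real.pi * Complex.I : ℂ) := by
        rw [← Pi.single_smul, smul_eq_mul, div_mul_cancel₀ _ hpi]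
      rw [h2, hC, Pi.smul_apply, hk, smul_eq_mul]
      field_simp
    conv_lhs => rw [← Finset.univ_sum_single u]
    rw [map_sum, Finset.sum_apply]
    exact Finset.sum_congr rfl fun l _ => h1 l
  refine ⟨fun j l => k l j, fun g j => ?_⟩
  obtain ⟨w, rfl⟩ := CTorus.exp_surjective g
  have h1 : torusHom ψ.weight (CTorus.exp w) = CTorus.exp (A (Lφ w)) := by
    rw [hA, Lφ.symm_apply_apply]
  rw [h1, hLφ, CTorus.coe_exp, hAk, Complex.exp_sum]
  refine Finset.prod_congr rfl fun l _ => ?_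
  rw [CTorus.coe_exp, ← Complex.exp_int_mul]

end EquivariantChart

/-! ### Atlases with monomial transition maps -/

/-- A finite atlas with values in `ℂ^n` in which the points with non-vanishing coordinates are the
same for all charts, and on these points the transition maps are Laurent monomials. The matrix
`mat b a` has as rows the exponents of the coordinates of the chart `b` in those of the chart `a`;
the chart `base` is used to identify the lattice of one-parameter subgroups with `ℤ^n`. -/
structure MonomialAtlas (n : ℕ) (X : Type*) [TopologicalSpace X] (ι : Type*) where
  /-- the charts -/
  chart : ι → OpenPartialHomeomorph X (Fin n → ℂ)
  /-- the exponents of the transition maps -/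
  mat : ι → ι → Matrix (Fin n) (Fin n) ℤ
  /-- the chart that defines the coordinates of the lattice -/
  base : ι
  target_eq : ∀ a, (chart a).target = Set.univ
  mat_mul : ∀ a b c, mat a b * mat b c = mat a c
  mat_self : ∀ a, mat a a = 1
  mem_source : ∀ a b, ∀ x ∈ (chart a).source, (∀ i, chart a x i ≠ 0) → x ∈ (chart b).source
  trans : ∀ a b, ∀ x ∈ (chart a).source, (∀ i, chart a x i ≠ 0) →
    ∀ j, chart b x j = ∏ l, chart a x l ^ mat b a j l
  cover : ∀ x, ∃ a, x ∈ (chart a).source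

/-- Laurent monomials are continuous at points where the vanishing coordinates have
non-negative exponents. -/
theorem continuousAt_prod_zpow {n : ℕ} {w : Fin n → ℂ} {k : Fin n → ℤ}
    (h : ∀ l, w l = 0 → 0 ≤ k l) : ContinuousAt (fun z : Fin n → ℂ => ∏ l, z l ^ k l) w := by
  refine tendsto_finsetProd _ fun l _ => ?_
  refine ContinuousAt.zpow₀ (continuous_apply l).continuousAt _ ?_
  by_cases hl : w l = 0
  · exact Or.inr (h l hl)
  · exact Or.inl hl

/-- A path `s ↦ w + s * 1_{w = 0}`, along which the vanishing coordinates of `w` become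
non-zero. -/
def perturb {n : ℕ} (w : Fin n → ℂ) (s : ℂ) : Fin n → ℂ := fun l => if w l = 0 then s else w l

theorem perturb_ne_zero {n : ℕ} (w : Fin n → ℂ) {s : ℂ} (hs : s ≠ 0) (l : Fin n) :
    perturb w s l ≠ 0 := by
  unfold perturb
  split_ifs with h
  exacts [hs, h]

theorem tendsto_perturb {n : ℕ} (w : Fin n → ℂ) :
    Filter.Tendsto (perturb w) (nhdsWithin 0 {0}ᶜ) (nhds w) := by
  have hc : Continuous (perturb w) := by
    refine continuous_pi fun l => ?_
    unfold perturb
    split_ifs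
    exacts [continuous_id, continuous_const]
  have h := hc.tendsto 0
  have h0 : perturb w 0 = w := by
    funext l
    unfold perturb
    split_ifs with hl
    exacts [hl.symm, rfl]
  rw [h0] at h
  exact h.mono_left nhdsWithin_le_nhds

namespace MonomialAtlas

open Filter Topology

variable {n : ℕ} {X : Type*} [TopologicalSpace X] {ι : Type*} (A : MonomialAtlas n X ι)

theorem mem_target (a : ι) (w : Fin n → ℂ) : w ∈ (A.chart a).target := by
  rw [A.target_eq]; trivial

theorem symm_mem (a : ι) (w : Fin n → ℂ) : (A.chart a).symm w ∈ (A.chart a).source :=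
  (A.chart a).map_target (A.mem_target a w)

theorem apply_symm (a : ι) (w : Fin n → ℂ) : A.chart a ((A.chart a).symm w) = w :=
  (A.chart a).right_inv (A.mem_target a w)

theorem continuous_symm (a : ι) : Continuous (A.chart a).symm := by
  have := (A.chart a).continuousOn_symm
  rwa [A.target_eq, continuousOn_univ] at this

theorem trans_symm (a b : ι) {w : Fin n → ℂ} (hw : ∀ i, w i ≠ 0) (j : Fin n) :
    A.chart b ((A.chart a).symm w) j = ∏ l, w l ^ A.mat b a j l := by
  rw [A.trans a b _ (A.symm_mem a w) (by rwa [A.apply_symm]), A.apply_symm]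

theorem symm_eq (a b : ι) {w : Fin n → ℂ} (hw : ∀ i, w i ≠ 0) :
    (A.chart b).symm (fun j => ∏ l, w l ^ A.mat b a j l) = (A.chart a).symm w := by
  have h : (A.chart a).symm w ∈ (A.chart b).source :=
    A.mem_source a b _ (A.symm_mem a w) (by rwa [A.apply_symm])
  rw [← funext (A.trans_symm a b hw), (A.chart b).left_inv h]

/-- Where two charts are both defined, the transition map has no poles along the coordinate
hyperplanes. -/
theorem mat_nonneg {a b : ι} {x : X} (ha : x ∈ (A.chart a).source) (hb : x ∈ (A.chart b).source)
    {i : Fin n} (hi : A.chart a x i = 0) (j : Fin n) : 0 ≤ A.mat b a j i := by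
  by_contra hneg
  push Not at hneg
  have hN : IsOpen ((A.chart a).symm ⁻¹' (A.chart b).source) :=
    (A.chart b).open_source.preimage (A.continuous_symm a)
  -- a point of the same coordinate hyperplane with all other coordinates non-zero
  obtain ⟨p, hpN, hpi, hp⟩ : ∃ p, p ∈ (A.chart a).symm ⁻¹' (A.chart b).source ∧ p i = 0 ∧
      ∀ l, l ≠ i → p l ≠ 0 := by
    set w := A.chart a x
    have hwN : w ∈ (A.chart a).symm ⁻¹' (A.chart b).source := by
      simpa [w, (A.chart a).left_inv ha] using hb
    have ht : Tendsto (fun s => Function.update (perturb w s) i 0) (𝓝[≠] 0) (𝓝 w) := by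
      have := (tendsto_perturb w).update i (tendsto_const_nhds (x := w i))
      rwa [Function.update_eq_self, hi] at this
    obtain ⟨s, hs, hs0⟩ := ((ht.eventually (hN.mem_nhds hwN)).and self_mem_nhdsWithin).exists
    refine ⟨_, hs, by simp, fun l hl => ?_⟩
    rw [Function.update_of_ne hl]
    exact perturb_ne_zero w hs0 l
  have hτ : ContinuousAt (fun z => A.chart b ((A.chart a).symm z) j) p :=
    (continuous_apply j).continuousAt.comp
      (((A.chart b).continuousAt hpN).comp (A.continuous_symm a).continuousAt)
  have ht : Tendsto (fun s : ℂ => Function.update p i s) (𝓝[≠] 0) (𝓝 p) := by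
    have h1 : Continuous fun s : ℂ => Function.update p i s :=
      continuous_const.update i continuous_id
    have h2 := h1.tendsto 0
    rw [← hpi, Function.update_eq_self] at h2
    rw [← hpi]
    exact h2.mono_left nhdsWithin_le_nhds
  have h1 := (hτ.tendsto.comp ht).norm
  set c : ℂ := ∏ l ∈ Finset.univ.erase i, p l ^ A.mat b a j l
  have hc : c ≠ 0 := Finset.prod_ne_zero_iff.2 fun l hl =>
    zpow_ne_zero _ (hp l (Finset.ne_of_mem_erase hl))
  have h2 : Tendsto (fun s : ℂ => ‖s ^ A.mat b a j i‖ * ‖c‖) (𝓝[≠] 0) atTop :=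
    (tendsto_norm_cobounded_atTop.comp
      (tendsto_zpow_nhdsNE_zero_cobounded hneg)).atTop_mul_const (norm_pos_iff.2 hc)
  refine not_tendsto_nhds_of_tendsto_atTop h2 _ (h1.congr' ?_)
  filter_upwards [self_mem_nhdsWithin] with s hs
  have hne : ∀ l, Function.update p i s l ≠ 0 := by
    intro l
    by_cases hl : l = i
    · subst hl; simpa using hs
    · rw [Function.update_of_ne hl]; exact hp l hl
  simp only [Function.comp_apply]
  rw [A.trans_symm a b hne, ← Finset.mul_prod_erase _ _ (Finset.mem_univ i), norm_mul,
    Function.update_self]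
  congr 2
  refine Finset.prod_congr rfl fun l hl => ?_
  rw [Function.update_of_ne (Finset.ne_of_mem_erase hl)]

/-- The monomial formula for the transition map holds wherever both charts are defined. -/
theorem trans_of_mem {a b : ι} {x : X} (ha : x ∈ (A.chart a).source)
    (hb : x ∈ (A.chart b).source) (j : Fin n) :
    A.chart b x j = ∏ l, A.chart a x l ^ A.mat b a j l := by
  have h1 := (continuousAt_prod_zpow (w := A.chart a x) (k := A.mat b a j) fun l hl =>
    A.mat_nonneg ha hb hl j).tendsto.comp (tendsto_perturb _)
  have h2 : Tendsto (fun s => A.chart b ((A.chart a).symm (perturb (A.chart a x) s)) j)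
      (𝓝[≠] 0) (𝓝 (A.chart b x j)) := by
    have h3 := (A.continuous_symm a).continuousAt.tendsto.comp (tendsto_perturb (A.chart a x))
    rw [(A.chart a).left_inv ha] at h3
    exact ((continuous_apply j).tendsto _).comp
      (((A.chart b).continuousAt hb).tendsto.comp h3)
  refine tendsto_nhds_unique h2 (h1.congr' ?_)
  filter_upwards [self_mem_nhdsWithin] with s hs
  exact (A.trans_symm a b (perturb_ne_zero _ hs) j).symm

/-! ### The rays of the fan -/

/-- The ray of the coordinate hyperplane `i` of the chart `a`: the one-parameter subgroup that
is the `i`-th coordinate axis in the chart `a`. -/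
def ray (a : ι) (i : Fin n) : Fin n → ℤ := fun l => A.mat A.base a l i

theorem ray_eq_sum (a b : ι) (j l : Fin n) :
    A.ray b j l = ∑ i, A.mat a b i j * A.ray a i l := by
  change A.mat A.base b l j = _
  rw [← A.mat_mul A.base a b, Matrix.mul_apply]
  exact Finset.sum_congr rfl fun i _ => mul_comm _ _

/-- The generators of the rays of a chart form a basis of the lattice. -/
def rayBasis (a : ι) : Module.Basis (Fin n) ℤ (Fin n → ℤ) :=
  (Pi.basisFun ℤ (Fin n)).map (Matrix.toLin'OfInv
    (by rw [A.mat_mul, A.mat_self] : A.mat a A.base * A.mat A.base a = 1)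
    (by rw [A.mat_mul, A.mat_self]))

theorem rayBasis_apply (a : ι) (i : Fin n) : A.rayBasis a i = A.ray a i := by
  funext l
  simp [rayBasis, ray, Matrix.toLin'OfInv]

theorem ray_injective (a : ι) : Function.Injective (A.ray a) := by
  have h := (A.rayBasis a).injective
  rwa [funext (A.rayBasis_apply a)] at h

/-- If the `i`-th ray of the chart `a` is the `j`-th ray of the chart `b`, the corresponding column
of the transition matrix is a unit vector. -/
theorem mat_of_ray_eq {a b : ι} {i j : Fin n} (h : A.ray b j = A.ray a i) (k : Fin n) :
    A.mat b a k i = if k = j then 1 else 0 := by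
  have h1 : A.mat b a k i = (A.mat b A.base * A.mat A.base a) k i := by rw [A.mat_mul]
  have h2 : (1 : Matrix (Fin n) (Fin n) ℤ) k j = (A.mat b A.base * A.mat A.base b) k j := by
    rw [A.mat_mul, A.mat_self]
  rw [← Matrix.one_apply, h1, h2, Matrix.mul_apply, Matrix.mul_apply]
  exact Finset.sum_congr rfl fun l _ => by
    rw [show A.mat A.base a l i = A.mat A.base b l j from (congrFun h l).symm]

/-- The rays of the coordinate hyperplanes through a point do not depend on the chart: a
non-negative integral matrix with non-negative inverse is a permutation matrix. -/
theorem exists_ray_eq {a b : ι} {x : X} (ha : x ∈ (A.chart a).source)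
    (hb : x ∈ (A.chart b).source) {i : Fin n} (hi : A.chart a x i = 0) :
    ∃ j, A.chart b x j = 0 ∧ A.ray b j = A.ray a i := by
  have hB := A.mat_nonneg ha hb hi
  have hzero : ∀ j, A.mat b a j i ≠ 0 → A.chart b x j = 0 := by
    intro j hj
    rw [A.trans_of_mem ha hb j]
    refine Finset.prod_eq_zero (Finset.mem_univ i) ?_
    rw [hi, zero_zpow _ hj]
  have hnonneg : ∀ k j, 0 ≤ A.mat a b k j * A.mat b a j i := by
    intro k j
    by_cases hj : A.mat b a j i = 0
    · simp [hj]
    · exact mul_nonneg (A.mat_nonneg hb ha (hzero j hj) k) (hB j)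
  have hsum : ∀ k, ∑ j, A.mat a b k j * A.mat b a j i = if k = i then 1 else 0 := by
    intro k
    rw [← Matrix.mul_apply, A.mat_mul, A.mat_self, Matrix.one_apply]
  obtain ⟨j, hj⟩ : ∃ j, A.mat a b i j * A.mat b a j i ≠ 0 := by
    by_contra hall
    push Not at hall
    have h := hsum i
    rw [Finset.sum_eq_zero fun j _ => hall j] at h
    simp at h
  have hji : A.mat b a j i ≠ 0 := right_ne_zero_of_mul hj
  have hone : A.mat a b i j = 1 := by
    have h1 := Finset.single_le_sum (f := fun j => A.mat a b i j * A.mat b a j i)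
      (fun j _ => hnonneg i j) (Finset.mem_univ j)
    rw [hsum i, if_pos rfl] at h1
    have h2 : A.mat a b i j * A.mat b a j i = 1 :=
      le_antisymm h1 (lt_of_le_of_ne (hnonneg i j) hj.symm)
    exact (Int.mul_eq_one_iff_eq_one_or_neg_one.1 h2).elim (fun h => h.1) fun h => by
      have := hB j
      omega
  have hoff : ∀ k, k ≠ i → A.mat a b k j = 0 := by
    intro k hk
    have h1 := (Finset.sum_eq_zero_iff_of_nonneg fun j _ => hnonneg k j).1
      ((hsum k).trans (if_neg hk)) j (Finset.mem_univ j)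
    exact (mul_eq_zero.1 h1).resolve_right hji
  refine ⟨j, hzero j hji, funext fun l => ?_⟩
  rw [A.ray_eq_sum a b, Finset.sum_eq_single i (fun k _ hk => by rw [hoff k hk, zero_mul])
    (by simp), hone, one_mul]

/-! ### Limits of one-parameter subgroups -/

/-- The coordinates of a real vector in the basis of the rays of a chart. -/
def rayCoord (a : ι) (v : Fin n → ℝ) (j : Fin n) : ℝ := ∑ l, (A.mat a A.base j l : ℝ) * v l

theorem rayCoord_sum_ray (a : ι) (c : Fin n → ℝ) (j : Fin n) :
    A.rayCoord a (fun l => ∑ i, c i * (A.ray a i l : ℝ)) j = c j := by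
  have h : ∀ i, ∑ l, (A.mat a A.base j l : ℝ) * (A.ray a i l : ℝ) = if j = i then 1 else 0 := by
    intro i
    have h1 : (A.mat a A.base * A.mat A.base a) j i = if j = i then 1 else 0 := by
      rw [A.mat_mul, A.mat_self, Matrix.one_apply]
    rw [Matrix.mul_apply] at h1
    exact_mod_cast h1
  simp only [rayCoord, Finset.mul_sum]
  rw [Finset.sum_comm]
  have h2 : ∀ i, ∑ l, (A.mat a A.base j l : ℝ) * (c i * (A.ray a i l : ℝ))
      = c i * if j = i then 1 else 0 := by
    intro i
    rw [← h i, Finset.mul_sum]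
    exact Finset.sum_congr rfl fun l _ => by ring
  rw [Finset.sum_congr rfl fun i _ => h2 i]
  simp

theorem sum_rayCoord (a : ι) (v : Fin n → ℝ) (l : Fin n) :
    ∑ i, A.rayCoord a v i * (A.ray a i l : ℝ) = v l := by
  have h : ∀ k, ∑ i, (A.ray a i l : ℝ) * (A.mat a A.base i k : ℝ) = if l = k then 1 else 0 := by
    intro k
    have h1 : (A.mat A.base a * A.mat a A.base) l k = if l = k then 1 else 0 := by
      rw [A.mat_mul, A.mat_self, Matrix.one_apply]
    rw [Matrix.mul_apply] at h1
    exact_mod_cast h1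
  simp only [rayCoord, Finset.sum_mul]
  rw [Finset.sum_comm]
  have h2 : ∀ k, ∑ i, (A.mat a A.base i k : ℝ) * v k * (A.ray a i l : ℝ)
      = v k * if l = k then 1 else 0 := by
    intro k
    rw [← h k, Finset.mul_sum]
    exact Finset.sum_congr rfl fun l _ => by ring
  rw [Finset.sum_congr rfl fun i _ => h2 i]
  simp

/-- The orbit of the point `(1, …, 1)` under the one-parameter semigroup `s ↦ exp (-s v)`. -/
def flow (v : Fin n → ℝ) (s : ℝ) : X :=
  (A.chart A.base).symm fun l => Complex.exp (-(s * v l : ℝ))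

theorem flow_eq (a : ι) (v : Fin n → ℝ) (s : ℝ) :
    A.flow v s = (A.chart a).symm fun j => Complex.exp (-(s * A.rayCoord a v j : ℝ)) := by
  unfold flow
  rw [← A.symm_eq A.base a fun i => Complex.exp_ne_zero _]
  congr 1
  funext j
  have h : ∀ l, Complex.exp (-(s * v l : ℝ)) ^ A.mat a A.base j l
      = Complex.exp (-(s * (A.mat a A.base j l * v l) : ℝ)) := by
    intro l
    rw [← Complex.exp_int_mul]
    congr 1
    push_cast
    ring
  rw [Finset.prod_congr rfl fun l _ => h l, ← Complex.exp_sum]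
  congr 1
  simp only [rayCoord]
  push_cast
  rw [Finset.mul_sum, Finset.sum_neg_distrib]

theorem tendsto_flow {a : ι} {v : Fin n → ℝ} (h : ∀ j, 0 ≤ A.rayCoord a v j) :
    Tendsto (A.flow v) atTop
      (𝓝 ((A.chart a).symm fun j => if A.rayCoord a v j = 0 then 1 else 0)) := by
  rw [show A.flow v = _ from funext (A.flow_eq a v)]
  refine ((A.continuous_symm a).tendsto _).comp (tendsto_pi_nhds.2 fun j => ?_)
  split_ifs with hj
  · simp [hj]
  · have hpos := lt_of_le_of_ne (h j) (Ne.symm hj)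
    refine tendsto_zero_iff_norm_tendsto_zero.2 ?_
    have h1 : Tendsto (fun s : ℝ => Real.exp (-(s * A.rayCoord a v j))) atTop (𝓝 0) :=
      Real.tendsto_exp_atBot.comp (tendsto_neg_atTop_atBot.comp (tendsto_id.atTop_mul_const hpos))
    refine h1.congr fun s => ?_
    rw [← Complex.ofReal_neg, ← Complex.ofReal_exp, Complex.norm_real, Real.norm_eq_abs,
      Real.abs_exp]

/-- Each vector lies in the cone of some chart: by compactness the corresponding one-parameter
semigroup has a limit point, whose coordinates are finite. -/
theorem exists_rayCoord_nonneg [CompactSpace X] (v : Fin n → ℝ) :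
    ∃ a, ∀ j, 0 ≤ A.rayCoord a v j := by
  obtain ⟨x, -, hx⟩ := isCompact_univ (X := X) (f := map (A.flow v) atTop) (by simp)
  obtain ⟨a, ha⟩ := A.cover x
  refine ⟨a, fun j => ?_⟩
  by_contra hneg
  push Not at hneg
  have hfin : ∀ᶠ y in 𝓝 x, ‖A.chart a y j‖ < ‖A.chart a x j‖ + 1 := by
    have hc : ContinuousAt (fun y => ‖A.chart a y j‖) x :=
      ((continuous_apply j).continuousAt.comp ((A.chart a).continuousAt ha)).norm
    exact hc.eventually_lt continuousAt_const (lt_add_one _)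
  have hinf : Tendsto (fun s => ‖A.chart a (A.flow v s) j‖) atTop atTop := by
    have h1 : Tendsto (fun s : ℝ => Real.exp (-(s * A.rayCoord a v j))) atTop atTop :=
      Real.tendsto_exp_atTop.comp (tendsto_neg_atBot_atTop.comp
        (tendsto_id.atTop_mul_const_of_neg hneg))
    refine h1.congr fun s => ?_
    rw [A.flow_eq a, A.apply_symm, ← Complex.ofReal_neg, ← Complex.ofReal_exp, Complex.norm_real,
      Real.norm_eq_abs, Real.abs_exp]
  have h2 : ∀ᶠ y in map (A.flow v) atTop, ‖A.chart a x j‖ + 1 ≤ ‖A.chart a y j‖ :=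
    hinf.eventually_ge_atTop _
  obtain ⟨y, hy1, hy2⟩ := ((hx.frequently hfin).and_eventually h2).exists
  exact absurd hy2 (not_le.2 hy1)

/-- The minimal face containing a vector does not depend on the cone that contains it: it is given
by the coordinate hyperplanes through the limit of the one-parameter semigroup. -/
theorem exists_ray_eq_of_rayCoord_pos [T2Space X] {a b : ι} {v : Fin n → ℝ}
    (ha : ∀ j, 0 ≤ A.rayCoord a v j) (hb : ∀ j, 0 ≤ A.rayCoord b v j) {i : Fin n}
    (hi : A.rayCoord a v i ≠ 0) : ∃ j, A.rayCoord b v j ≠ 0 ∧ A.ray b j = A.ray a i := by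
  have hlim := tendsto_nhds_unique (A.tendsto_flow ha) (A.tendsto_flow hb)
  have hxb := A.symm_mem b fun j => if A.rayCoord b v j = 0 then 1 else 0
  rw [← hlim] at hxb
  obtain ⟨j, hj, hr⟩ := A.exists_ray_eq (A.symm_mem a _) hxb (i := i) (by
    rw [A.apply_symm, if_neg hi])
  refine ⟨j, fun h0 => ?_, hr⟩
  rw [hlim, A.apply_symm, if_pos h0] at hj
  exact one_ne_zero hj

end MonomialAtlas

namespace MonomialAtlas

open NonsingularCompleteFan Filter Topology

variable {n : ℕ} {X : Type*} [TopologicalSpace X] {ι : Type*} [Fintype ι]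
  (A : MonomialAtlas n X ι)

/-! ### The fan of a monomial atlas -/

/-- The set of rays of all charts. -/
def rays : Finset (Fin n → ℤ) := by
  classical
  exact Finset.univ.image fun p : ι × Fin n => A.ray p.1 p.2

theorem ray_mem_rays (a : ι) (i : Fin n) : A.ray a i ∈ A.rays := by
  classical
  exact Finset.mem_image.2 ⟨(a, i), Finset.mem_univ _, rfl⟩

/-- The generator with a given number. -/
def gen (r : Fin A.rays.card) : Fin n → ℤ := (A.rays.equivFin.symm r : Fin n → ℤ)

/-- The number of the `i`-th ray of the chart `a`. -/
def num (a : ι) : Fin n ↪ Fin A.rays.card where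
  toFun i := A.rays.equivFin ⟨A.ray a i, A.ray_mem_rays a i⟩
  inj' _ _ h := A.ray_injective a (congrArg Subtype.val (A.rays.equivFin.injective h))

theorem num_apply (a : ι) (i : Fin n) :
    A.num a i = A.rays.equivFin ⟨A.ray a i, A.ray_mem_rays a i⟩ := rfl

theorem gen_num (a : ι) (i : Fin n) : A.gen (A.num a i) = A.ray a i := by
  rw [gen, num_apply, Equiv.symm_apply_apply]

theorem num_eq_num_iff {a b : ι} {i j : Fin n} :
    A.num a i = A.num b j ↔ A.ray a i = A.ray b j := by
  constructor
  · intro h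
    rw [← gen_num, h, gen_num]
  · intro h
    rw [num_apply, num_apply]
    simp only [h]

/-- The numbers of the rays of a chart. -/
def cone (a : ι) : Finset (Fin A.rays.card) := Finset.univ.map (A.num a)

theorem mem_cone {a : ι} {r : Fin A.rays.card} : r ∈ A.cone a ↔ ∃ i, A.num a i = r := by
  simp [cone]

theorem num_mem_cone (a : ι) (i : Fin n) : A.num a i ∈ A.cone a := A.mem_cone.2 ⟨i, rfl⟩

theorem card_cone (a : ι) : (A.cone a).card = n := by simp [cone]

theorem exists_num (r : Fin A.rays.card) : ∃ a i, A.num a i = r := by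
  classical
  obtain ⟨⟨a, i⟩, -, h⟩ := Finset.mem_image.1 (A.rays.equivFin.symm r).2
  refine ⟨a, i, ?_⟩
  rw [num_apply, ← Equiv.eq_symm_apply]
  exact Subtype.ext h

theorem mem_rayCone_iff {a : ι} {K : Finset (Fin A.rays.card)} (hK : K ⊆ A.cone a)
    (v : Fin n → ℝ) : v ∈ rayCone A.gen K ↔
      (∀ j, 0 ≤ A.rayCoord a v j) ∧ ∀ j, A.num a j ∉ K → A.rayCoord a v j = 0 := by
  classical
  have hsum : ∀ (c : Fin A.rays.card → ℝ) (l : Fin n), ∑ r ∈ K, c r * (A.gen r l : ℝ)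
      = ∑ i, (if A.num a i ∈ K then c (A.num a i) else 0) * (A.ray a i l : ℝ) := by
    intro c l
    have h1 : ∑ r ∈ K, c r * (A.gen r l : ℝ)
        = ∑ r ∈ A.cone a, (if r ∈ K then c r else 0) * (A.gen r l : ℝ) := by
      rw [← Finset.sum_subset hK fun r _ hr => by rw [if_neg hr, zero_mul]]
      exact Finset.sum_congr rfl fun r hr => by rw [if_pos hr]
    rw [h1, cone, Finset.sum_map]
    simp only [gen_num]
  constructor
  · rintro ⟨c, hc, hv⟩
    have hco : ∀ j, A.rayCoord a v j = if A.num a j ∈ K then c (A.num a j) else 0 := by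
      intro j
      rw [show v = _ from funext fun l => (hv l).trans (hsum c l), A.rayCoord_sum_ray]
    refine ⟨fun j => ?_, fun j hj => by rw [hco, if_neg hj]⟩
    rw [hco]
    split_ifs
    exacts [hc _, le_rfl]
  · rintro ⟨h0, hz⟩
    refine ⟨fun r => if h : ∃ i, A.num a i = r then A.rayCoord a v h.choose else 0, fun r => ?_,
      fun l => ?_⟩
    · dsimp only
      split_ifs
      exacts [h0 _, le_rfl]
    · rw [hsum, ← A.sum_rayCoord a v l]
      refine Finset.sum_congr rfl fun i _ => ?_
      congr 1
      split_ifs with h1 h2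
      · have := (A.num a).injective h2.choose_spec
        rw [this]
      · exact absurd ⟨i, rfl⟩ h2
      · exact hz i h1

variable [CompactSpace X] [T2Space X]

/-- The fan whose maximal cones are spanned by the rays of the charts. -/
abbrev fan : NonsingularCompleteFan n where
  m := A.rays.card
  simplices := {K | ∃ a, K ⊆ A.cone a}
  ray := A.gen
  empty_mem := ⟨A.base, Finset.empty_subset _⟩
  vertex_mem r := by
    obtain ⟨a, i, rfl⟩ := A.exists_num r
    exact ⟨a, Finset.singleton_subset_iff.2 (A.num_mem_cone a i)⟩
  down_closed := by
    rintro I ⟨a, ha⟩ K hK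
    exact ⟨a, hK.trans ha⟩
  nonsingular := by
    rintro I ⟨a, ha⟩
    choose f hf using fun r : I => A.mem_cone.1 (ha r.2)
    refine ⟨A.rayBasis a, ⟨f, fun r s h => Subtype.ext ?_⟩, fun r => ?_⟩
    · rw [← hf r, ← hf s, h]
    · change A.rayBasis a (f r) = A.gen r
      rw [A.rayBasis_apply, ← A.gen_num, hf]
  inter := by
    rintro I ⟨a, ha⟩ K ⟨b, hb⟩
    ext v
    rw [Set.mem_inter_iff, A.mem_rayCone_iff ha, A.mem_rayCone_iff hb,
      A.mem_rayCone_iff (Finset.inter_subset_left.trans ha)]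
    constructor
    · rintro ⟨⟨h1, h2⟩, h3, h4⟩
      refine ⟨h1, fun j hj => ?_⟩
      by_contra hne
      obtain ⟨k, hk, hr⟩ := A.exists_ray_eq_of_rayCoord_pos h1 h3 hne
      rw [← A.num_eq_num_iff] at hr
      refine hj (Finset.mem_inter.2 ⟨by_contra fun h => hne (h2 j h), ?_⟩)
      rw [← hr]
      exact by_contra fun h => hk (h4 k h)
    · intro h
      have h' := (A.mem_rayCone_iff (Finset.inter_subset_left.trans ha) v).2 h
      rw [A.mem_rayCone_iff (Finset.inter_subset_right.trans hb)] at h'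
      exact ⟨⟨h.1, fun j hj => h.2 j fun hm => hj (Finset.mem_inter.1 hm).1⟩, h'.1,
        fun j hj => h'.2 j fun hm => hj (Finset.mem_inter.1 hm).2⟩
  complete v := by
    obtain ⟨a, ha⟩ := A.exists_rayCoord_nonneg v
    exact ⟨A.cone a, ⟨a, subset_rfl⟩, (A.mem_rayCone_iff subset_rfl v).2
      ⟨ha, fun j hj => absurd (A.num_mem_cone a j) hj⟩⟩

/-- The maximal cone of a chart. -/
def facet (a : ι) : A.fan.Facet := ⟨A.cone a, ⟨a, subset_rfl⟩, A.card_cone a⟩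

theorem exists_facet_eq (I : A.fan.Facet) : ∃ a, I = A.facet a := by
  obtain ⟨a, ha⟩ := I.2.1
  refine ⟨a, Subtype.ext (Finset.eq_of_subset_of_card_le ha ?_)⟩
  exact (A.card_cone a).le.trans I.2.2.ge

/-- The enumeration of the rays of a chart by the corresponding maximal cone of the fan differs
from the enumeration by the coordinates of the chart by this permutation. -/
def perm (a : ι) : Equiv.Perm (Fin n) :=
  Equiv.ofBijective (fun i => (A.facet a).idx ⟨A.num a i, A.num_mem_cone a i⟩)
    (Finite.injective_iff_bijective.1 fun _ _ h =>
      (A.num a).injective (congrArg Subtype.val ((A.facet a).idx.injective h)))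

theorem perm_symm_idx (a : ι) (i : Fin n) (h : A.num a i ∈ (A.facet a).1) :
    (A.perm a).symm ((A.facet a).idx ⟨A.num a i, h⟩) = i := by
  rw [Equiv.symm_apply_eq]
  rfl

theorem pairing_perm (a b : ι) (i j : Fin n) :
    (A.facet a).pairing (A.perm a i) (A.num b j) = A.mat a b i j := by
  have hb : ∀ k, (A.facet a).basis (A.perm a k) = A.ray a k := fun k =>
    ((A.facet a).basis_idx _).trans (A.gen_num a k)
  have hr : A.fan.ray (A.num b j)
      = ∑ k, A.mat a b k j • (A.facet a).basis (A.perm a k) := by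
    funext l
    rw [Finset.sum_apply]
    simp only [Pi.smul_apply, hb, smul_eq_mul]
    rw [← A.ray_eq_sum a b]
    exact congrFun (A.gen_num b j) l
  unfold Facet.pairing
  rw [hr, map_sum, Finset.sum_eq_single i]
  · rw [map_smul, Module.Basis.coord_apply, Module.Basis.repr_self, Finsupp.single_eq_same,
      smul_eq_mul, mul_one]
  · intro k _ hk
    have hne : A.perm a k ≠ A.perm a i := fun h => hk ((A.perm a).injective h)
    rw [map_smul, Module.Basis.coord_apply, Module.Basis.repr_self,
      Finsupp.single_eq_of_ne hne.symm, smul_zero]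
  · simp

/-! ### The isomorphism with the toric manifold of the fan -/

/-- The point with coordinates `w` at the rays of the chart `a` and `1` elsewhere. -/
def homog (a : ι) (w : Fin n → ℂ) : A.fan.U :=
  ToricManifold.chartSection (A.facet a) fun k => w ((A.perm a).symm k)

theorem homog_num (a : ι) (w : Fin n → ℂ) (i : Fin n) : (A.homog a w).1 (A.num a i) = w i := by
  have h : A.num a i ∈ (A.facet a).1 := A.num_mem_cone a i
  simp only [homog, ToricManifold.chartSection]
  rw [dif_pos h, A.perm_symm_idx]

theorem homog_of_notMem (a : ι) (w : Fin n → ℂ) {r : Fin A.fan.m} (hr : r ∉ A.cone a) :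
    (A.homog a w).1 r = 1 := by
  simp only [homog, ToricManifold.chartSection]
  exact dif_neg hr

theorem preChart_homog (a b : ι) (w : Fin n → ℂ) (i : Fin n) :
    ToricManifold.preChart (A.facet a) (A.homog b w) (A.perm a i)
      = ∏ j, w j ^ A.mat a b i j := by
  unfold ToricManifold.preChart
  rw [← Finset.prod_subset (Finset.subset_univ (A.cone b)) fun r _ hr => by
    rw [A.homog_of_notMem b w hr, one_zpow], cone]
  refine (Finset.prod_map _ _ _).trans (Finset.prod_congr rfl fun j _ => ?_)
  rw [A.homog_num, A.pairing_perm]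

theorem chart_facet_homog (a : ι) (w : Fin n → ℂ) (i : Fin n) :
    ToricManifold.chart (A.facet a) (ToricManifold.mk A.fan (A.homog a w)) (A.perm a i) = w i := by
  rw [ToricManifold.chart_mk, A.preChart_homog, A.mat_self]
  rw [Finset.prod_eq_single i (fun j _ hj => by rw [Matrix.one_apply_ne hj.symm, zpow_zero])
    (by simp), Matrix.one_apply_eq, zpow_one]

/-- The map to the toric manifold in homogeneous coordinates. -/
def toToric (x : X) : A.fan.ToricManifold :=
  ToricManifold.mk A.fan (A.homog (A.cover x).choose (A.chart (A.cover x).choose x))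

theorem toToric_eq {a : ι} {x : X} (ha : x ∈ (A.chart a).source) :
    A.toToric x = ToricManifold.mk A.fan (A.homog a (A.chart a x)) := by
  unfold toToric
  set b := (A.cover x).choose
  have hb : x ∈ (A.chart b).source := (A.cover x).choose_spec
  rw [← ToricManifold.mk_chartSection_preChart (A.facet a) (z := A.homog b (A.chart b x))]
  · congr 1
    unfold homog
    congr 1
    funext k
    obtain ⟨i, rfl⟩ := (A.perm a).surjective k
    rw [Equiv.symm_apply_apply, A.trans_of_mem hb ha]
    exact A.preChart_homog a b _ i
  · intro r hr h0
    by_cases hrb : r ∈ A.cone b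
    · obtain ⟨j, rfl⟩ := A.mem_cone.1 hrb
      rw [A.homog_num] at h0
      obtain ⟨i, -, hi⟩ := A.exists_ray_eq hb ha h0
      rw [← A.num_eq_num_iff] at hi
      exact hr (hi ▸ A.num_mem_cone a i)
    · rw [A.homog_of_notMem b _ hrb] at h0
      exact one_ne_zero h0

theorem chart_facet_toToric {a : ι} {x : X} (ha : x ∈ (A.chart a).source) (i : Fin n) :
    ToricManifold.chart (A.facet a) (A.toToric x) (A.perm a i) = A.chart a x i := by
  rw [A.toToric_eq ha, A.chart_facet_homog]

/-- The preimage of an affine chart is the domain of the corresponding chart of `X`: a point of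
another chart whose image lies in the affine chart is a limit of points of the open orbit that
also converge in the chart `a`, and limits in `X` are unique. -/
theorem toToric_mem_chartSource {a : ι} {x : X} :
    A.toToric x ∈ ToricManifold.chartSource (A.facet a) ↔ x ∈ (A.chart a).source := by
  constructor
  · intro h
    obtain ⟨b, hb⟩ := A.cover x
    rw [A.toToric_eq hb, ToricManifold.mk_mem_chartSource] at h
    set w := A.chart b x
    have hexp : ∀ i l, w l = 0 → 0 ≤ A.mat a b i l := by
      intro i l hl
      have hmem : A.num b l ∈ A.cone a := by
        by_contra hn
        exact h _ hn (by rw [A.homog_num, hl])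
      obtain ⟨j, hj⟩ := A.mem_cone.1 hmem
      rw [A.mat_of_ray_eq (A.num_eq_num_iff.1 hj)]
      split_ifs <;> simp
    have h1 : Tendsto (fun s => (A.chart a).symm fun i => ∏ l, perturb w s l ^ A.mat a b i l)
        (𝓝[≠] 0) (𝓝 ((A.chart a).symm fun i => ∏ l, w l ^ A.mat a b i l)) :=
      ((A.continuous_symm a).tendsto _).comp (tendsto_pi_nhds.2 fun i =>
        (continuousAt_prod_zpow fun l hl => hexp i l hl).tendsto.comp (tendsto_perturb w))
    have h2 : Tendsto (fun s => (A.chart b).symm (perturb w s)) (𝓝[≠] 0) (𝓝 x) := by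
      have := ((A.continuous_symm b).tendsto w).comp (tendsto_perturb w)
      rwa [(A.chart b).left_inv hb] at this
    rw [tendsto_nhds_unique (h2.congr' ?_) h1]
    · exact A.symm_mem a _
    · filter_upwards [self_mem_nhdsWithin] with s hs
      exact (A.symm_eq b a (perturb_ne_zero w hs)).symm
  · intro ha
    rw [A.toToric_eq ha, ToricManifold.mk_mem_chartSource]
    exact fun r hr => by rw [A.homog_of_notMem a _ hr]; exact one_ne_zero

theorem toToric_bijective : Function.Bijective A.toToric := by
  constructor
  · intro x y h
    obtain ⟨a, ha⟩ := A.cover x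
    have hb : y ∈ (A.chart a).source := by
      rw [← A.toToric_mem_chartSource, ← h, A.toToric_mem_chartSource]
      exact ha
    refine (A.chart a).injOn ha hb (funext fun i => ?_)
    rw [← A.chart_facet_toToric ha, h, A.chart_facet_toToric hb]
  · intro y
    obtain ⟨I, hI⟩ := ToricManifold.exists_mem_chart_source y
    obtain ⟨a, rfl⟩ := A.exists_facet_eq I
    set u := ToricManifold.chart (A.facet a) y
    refine ⟨(A.chart a).symm fun i => u (A.perm a i), ?_⟩
    refine (ToricManifold.chart (A.facet a)).injOn ?_ hI (funext fun k => ?_)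
    · exact A.toToric_mem_chartSource.2 (A.symm_mem a _)
    · obtain ⟨i, rfl⟩ := (A.perm a).surjective k
      rw [A.chart_facet_toToric (A.symm_mem a _), A.apply_symm]

/-- Multiplying the coordinates of all charts by compatible torus elements corresponds to the torus
action on the toric manifold. -/
theorem toToric_of_mul {a : ι} {x y : X} (hx : x ∈ (A.chart a).source)
    (hy : y ∈ (A.chart a).source) {t t₀ : CTorus n}
    (hxy : ∀ i, A.chart a y i = (t : Fin n → ℂ) i * A.chart a x i)
    (ht : ∀ l, (t₀ : Fin n → ℂ) l = ∏ i, (t : Fin n → ℂ) i ^ A.mat A.base a l i) :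
    A.toToric y = t₀ • A.toToric x := by
  classical
  let h : CTorus A.fan.m := CTorus.ofCoords fun r : Fin A.rays.card =>
    if h : ∃ i, A.num a i = r then CTorus.coord h.choose t else 1
  have hnum : ∀ i, (h : Fin A.fan.m → ℂ) (A.num a i) = (t : Fin n → ℂ) i := by
    intro i
    have hex : ∃ j, A.num a j = A.num a i := ⟨i, rfl⟩
    rw [← CTorus.coe_coord, CTorus.coord_ofCoords, dif_pos hex,
      (A.num a).injective hex.choose_spec, CTorus.coe_coord]
  have hone : ∀ r, r ∉ A.cone a → (h : Fin A.fan.m → ℂ) r = 1 := by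
    intro r hr
    rw [← CTorus.coe_coord, CTorus.coord_ofCoords, dif_neg fun hex => hr (A.mem_cone.2 hex)]
    rfl
  have hlam : A.fan.lam h = t₀ := by
    refine CTorus.ext_coe fun l => ?_
    rw [coe_lam, ht, ← Finset.prod_subset (Finset.subset_univ (A.cone a)) fun r _ hr => by
      rw [hone r hr, one_zpow], cone]
    refine (Finset.prod_map _ _ _).trans (Finset.prod_congr rfl fun i _ => ?_)
    rw [hnum]
    congr 1
    exact congrFun (A.gen_num a i) l
  rw [A.toToric_eq hx, A.toToric_eq hy, ← hlam, ToricManifold.lam_smul_mk]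
  congr 1
  refine Subtype.ext (funext fun r => ?_)
  rw [NonsingularCompleteFan.smul_apply]
  by_cases hr : r ∈ A.cone a
  · obtain ⟨i, rfl⟩ := A.mem_cone.1 hr
    rw [hnum, A.homog_num, A.homog_num, hxy]
  · rw [hone r hr, A.homog_of_notMem a _ hr, A.homog_of_notMem a _ hr, one_mul]

end MonomialAtlas

/-! ### Biholomorphic equivalence with a toric manifold -/

/-- Laurent monomials on the torus have unique exponents. -/
theorem CTorus.exponent_unique {n : ℕ} {k k' : Fin n → ℤ}
    (h : ∀ t : CTorus n, ∏ l, (t : Fin n → ℂ) l ^ k l = ∏ l, (t : Fin n → ℂ) l ^ k' l) :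
    k = k' := by
  classical
  funext i
  let t : CTorus n := CTorus.ofCoords fun l => if l = i then Units.mk0 2 two_ne_zero else 1
  have ht : ∀ l, (t : Fin n → ℂ) l = if l = i then 2 else 1 := by
    intro l
    rw [← CTorus.coe_coord, CTorus.coord_ofCoords]
    split_ifs <;> rfl
  have hprod : ∀ k : Fin n → ℤ, ∏ l, (t : Fin n → ℂ) l ^ k l = (2 : ℂ) ^ k i := by
    intro k
    rw [Finset.prod_eq_single i (fun l _ hl => by rw [ht, if_neg hl, one_zpow]) (by simp), ht,
      if_pos rfl]
  have h2 : ((2 : ℝ) ^ k i) = 2 ^ k' i := by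
    apply Complex.ofReal_injective
    push_cast
    rw [← hprod, ← hprod, h t]
  exact zpow_right_injective₀ (by norm_num) (by norm_num) h2

/-- Substituting monomials into monomials multiplies the matrices of exponents. -/
theorem CTorus.prod_zpow_mul {n : ℕ} {M N : Matrix (Fin n) (Fin n) ℤ} {u v w : CTorus n}
    (hv : ∀ l, (v : Fin n → ℂ) l = ∏ k, (w : Fin n → ℂ) k ^ N l k)
    (hu : ∀ j, (u : Fin n → ℂ) j = ∏ l, (v : Fin n → ℂ) l ^ M j l) (j : Fin n) :
    (u : Fin n → ℂ) j = ∏ k, (w : Fin n → ℂ) k ^ (M * N) j k := by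
  rw [hu]
  simp only [hv, ← Finset.prod_zpow, ← zpow_mul]
  rw [Finset.prod_comm]
  refine Finset.prod_congr rfl fun k _ => ?_
  simp only [← CTorus.coe_coord, ← Units.val_zpow_eq_zpow_val, ← Units.coe_prod]
  rw [NonsingularCompleteFan.prod_zpow_exp, Matrix.mul_apply]
  simp only [mul_comm]

/-- A complex toric manifold is in particular a smooth manifold. -/
instance NonsingularCompleteFan.ToricManifold.isManifold_real {n : ℕ}
    (Δ : NonsingularCompleteFan n) : IsManifold 𝓘(ℝ, Fin n → ℂ) ∞ Δ.ToricManifold := by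
  refine isManifold_of_contDiffOn _ _ _ fun e e' he he' => ?_
  have h : e.symm ≫ₕ e' ∈ contDiffGroupoid ω 𝓘(ℂ, Fin n → ℂ) :=
    HasGroupoid.compatible he he'
  have h1 := (contMDiffOn_iff_contDiffOn.1
    (contMDiffOn_of_mem_contDiffGroupoid h)).restrict_scalars ℝ
  refine (h1.of_le le_top).mono fun w hw => ?_
  exact hw.1

/-- The tangent space of a manifold at a point is identified with the model space by the preferred
chart at the point, so the differential of a map can be computed after composition with it. -/
theorem hasMFDerivAt_of_chartAt_comp {E F H X Y : Type*} [NormedAddCommGroup E] [NormedSpace ℝ E]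
    [NormedAddCommGroup F] [NormedSpace ℝ F] [TopologicalSpace H] {I : ModelWithCorners ℝ E H}
    [TopologicalSpace X] [ChartedSpace H X] [TopologicalSpace Y] [ChartedSpace F Y]
    {f : X → Y} {x : X} (hf : ContinuousAt f x) {D : TangentSpace I x →L[ℝ] F}
    (h : HasMFDerivAt I 𝓘(ℝ, F) (fun y => chartAt F (f x) (f y)) x D) :
    HasMFDerivAt I 𝓘(ℝ, F) f x D := ⟨hf, h.2⟩

namespace MonomialAtlas

open NonsingularCompleteFan

variable {n : ℕ} {X : Type*} [TopologicalSpace X] {ι : Type*} [Fintype ι]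
  (A : MonomialAtlas n X ι) [CompactSpace X] [T2Space X]

/-- The permutation of coordinates between a chart of `X` and the corresponding chart of the toric
manifold. -/
def permCLE (a : ι) : (Fin n → ℂ) ≃L[ℂ] (Fin n → ℂ) :=
  (LinearEquiv.funCongrLeft ℂ ℂ (A.perm a).symm).toContinuousLinearEquiv

theorem permCLE_apply (a : ι) (w : Fin n → ℂ) (i : Fin n) :
    A.permCLE a w (A.perm a i) = w i := by
  change w ((A.perm a).symm (A.perm a i)) = w i
  rw [Equiv.symm_apply_apply]

theorem chart_toToric {a : ι} {x : X} (ha : x ∈ (A.chart a).source) :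
    ToricManifold.chart (A.facet a) (A.toToric x) = A.permCLE a (A.chart a x) := by
  funext k
  obtain ⟨i, rfl⟩ := (A.perm a).surjective k
  rw [A.chart_facet_toToric ha, permCLE_apply]

theorem toToric_eq_symm {a : ι} {x : X} (ha : x ∈ (A.chart a).source) :
    A.toToric x = (ToricManifold.chart (A.facet a)).symm (A.permCLE a (A.chart a x)) := by
  rw [← A.chart_toToric ha]
  exact ((ToricManifold.chart (A.facet a)).left_inv (A.toToric_mem_chartSource.2 ha)).symm

theorem chart_mem_maximalAtlas (a : ι) :
    ToricManifold.chart (A.facet a) ∈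
      IsManifold.maximalAtlas 𝓘(ℝ, Fin n → ℂ) ∞ A.fan.ToricManifold :=
  IsManifold.subset_maximalAtlas (Set.mem_range_self _)

theorem contDiff_permCLE (a : ι) : ContDiff ℝ ∞ (A.permCLE a) :=
  (A.permCLE a).contDiff.restrict_scalars ℝ

end MonomialAtlas

namespace EquivariantChart

open SmoothCharacter Set Filter Topology

variable {n : ℕ} {X : Type*} [TopologicalSpace X]
  [ChartedSpace (EuclideanSpace ℝ (Fin (2 * n))) X] [MulAction (CTorus n) X]
  [IsManifold (𝓡 (2 * n)) ∞ X] {J : AlmostComplexStructure n X}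
  {ι : Type*} (Φ : ι → EquivariantChart n X) {x₀ : X}

/-- The exponents of the characters of one adapted chart as monomials in those of another. -/
def transMatrix (hX : IsTopologicalToricManifold n X) {φ ψ : EquivariantChart n X}
    (hψ : ψ.IsAdapted J x₀) (hφ : φ.IsAdapted J x₀) : Matrix (Fin n) (Fin n) ℤ :=
  (hφ.exists_matrix hX hψ).choose

theorem torusHom_eq_prod (hX : IsTopologicalToricManifold n X) {φ ψ : EquivariantChart n X}
    (hψ : ψ.IsAdapted J x₀) (hφ : φ.IsAdapted J x₀) (g : CTorus n) (j : Fin n) :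
    (torusHom ψ.weight g : Fin n → ℂ) j
      = ∏ l, (torusHom φ.weight g : Fin n → ℂ) l ^ transMatrix hX hψ hφ j l :=
  (hφ.exists_matrix hX hψ).choose_spec g j

/-- Adapted charts that cover `X` form a monomial atlas. -/
def monomialAtlas (hX : IsTopologicalToricManifold n X)
    (ho : Dense (MulAction.orbit (CTorus n) x₀))
    (hs : ∀ φ : EquivariantChart n X, MulAction.orbit (CTorus n) x₀ ⊆ φ.source)
    (hΦ : ∀ a, (Φ a).IsAdapted J x₀) (hcover : ∀ x, ∃ a, x ∈ (Φ a).source) :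
    MonomialAtlas n X ι where
  chart a := (Φ a).toOpenPartialHomeomorph
  mat b a := transMatrix hX (hΦ b) (hΦ a)
  base := (hcover x₀).choose
  target_eq a := (Φ a).target_eq
  mat_mul a b c := by
    refine Matrix.ext fun j l => congrFun (CTorus.exponent_unique fun t => ?_) l
    obtain ⟨g, rfl⟩ := ((Φ c).torusHom_bijective hX).2 t
    rw [← torusHom_eq_prod hX (hΦ a) (hΦ c) g j]
    exact (CTorus.prod_zpow_mul (torusHom_eq_prod hX (hΦ b) (hΦ c) g)
      (torusHom_eq_prod hX (hΦ a) (hΦ b) g) j).symm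
  mat_self a := by
    refine Matrix.ext fun j l => congrFun (CTorus.exponent_unique fun t => ?_) l
    obtain ⟨g, rfl⟩ := ((Φ a).torusHom_bijective hX).2 t
    rw [← torusHom_eq_prod hX (hΦ a) (hΦ a) g j,
      Finset.prod_eq_single j (fun l _ hl => by rw [Matrix.one_apply_ne hl.symm, zpow_zero])
      (by simp), Matrix.one_apply_eq, zpow_one]
  mem_source a b x hx h0 := hs _ (((Φ a).mem_orbit_iff hX ho (hs _) x hx).2 h0)
  trans a b x hx h0 j := by
    obtain ⟨g, rfl⟩ := ((Φ a).mem_orbit_iff hX ho (hs _) x hx).2 h0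
    simp only [(hΦ a).apply_smul_base, (hΦ b).apply_smul_base]
    exact torusHom_eq_prod hX (hΦ b) (hΦ a) g j
  cover := hcover

section

variable (A : MonomialAtlas n X ι) (hA : ∀ a, A.chart a = (Φ a).toOpenPartialHomeomorph)
  [Fintype ι] [CompactSpace X] [T2Space X]

open NonsingularCompleteFan

include hA

omit [IsManifold (𝓡 (2 * n)) ∞ X] in
theorem contMDiff_toToric : ContMDiff (𝓡 (2 * n)) 𝓘(ℝ, Fin n → ℂ) ∞ A.toToric := by
  intro x
  obtain ⟨a, ha⟩ := A.cover x
  have h1 : ContMDiffAt (𝓡 (2 * n)) 𝓘(ℝ, Fin n → ℂ) ∞ (A.chart a) x := by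
    rw [hA] at ha ⊢
    exact (Φ a).contMDiffAt ha
  have h2 : ContMDiffAt 𝓘(ℝ, Fin n → ℂ) 𝓘(ℝ, Fin n → ℂ) ∞ (ToricManifold.chart (A.facet a)).symm
      (A.permCLE a (A.chart a x)) :=
    (contMDiffOn_symm_of_mem_maximalAtlas (A.chart_mem_maximalAtlas a)).contMDiffAt Filter.univ_mem
  have h3 := h2.comp x (((A.contDiff_permCLE a).contMDiff _).comp x h1)
  refine h3.congr_of_eventuallyEq ?_
  filter_upwards [(A.chart a).open_source.mem_nhds ha] with y hy
  exact A.toToric_eq_symm hy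

omit [IsManifold (𝓡 (2 * n)) ∞ X] in
theorem contMDiff_toToric_symm : ContMDiff 𝓘(ℝ, Fin n → ℂ) (𝓡 (2 * n)) ∞
    (Equiv.ofBijective _ A.toToric_bijective).symm := by
  intro y
  obtain ⟨x, rfl⟩ := A.toToric_bijective.2 y
  obtain ⟨a, ha⟩ := A.cover x
  have hmem := A.toToric_mem_chartSource.2 ha
  have hopen : IsOpen (ToricManifold.chartSource (A.facet a)) := ToricManifold.isOpen_chartSource _
  have h1 : ContMDiffAt 𝓘(ℝ, Fin n → ℂ) 𝓘(ℝ, Fin n → ℂ) ∞ (ToricManifold.chart (A.facet a))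
      (A.toToric x) :=
    (contMDiffOn_of_mem_maximalAtlas (A.chart_mem_maximalAtlas a)).contMDiffAt (hopen.mem_nhds hmem)
  have hP : ContDiff ℝ ∞ (A.permCLE a).symm := (A.permCLE a).symm.contDiff.restrict_scalars ℝ
  have h2 : ContMDiff 𝓘(ℝ, Fin n → ℂ) (𝓡 (2 * n)) ∞ (A.chart a).symm := by
    rw [hA]
    exact (Φ a).contMDiffAt_symm
  have h3 := (h2.comp hP.contMDiff).contMDiffAt.comp _ h1
  refine h3.congr_of_eventuallyEq ?_
  filter_upwards [hopen.mem_nhds hmem] with z hz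
  obtain ⟨w, rfl⟩ := A.toToric_bijective.2 z
  have hw := A.toToric_mem_chartSource.1 hz
  rw [Equiv.symm_apply_eq]
  simp only [Function.comp_apply]
  rw [A.chart_toToric hw, ContinuousLinearEquiv.symm_apply_apply, (A.chart a).left_inv hw]
  rfl

/-- In the affine charts the map to the toric manifold is an equivariant chart with permuted
coordinates, so it is holomorphic when the equivariant charts are. -/
theorem isHolomorphicOn_toToric (hJ : ∀ a, (Φ a).IsJLinear J) :
    J.IsHolomorphicOn A.toToric Set.univ := by
  refine ⟨(contMDiff_toToric Φ A hA).contMDiffOn, fun x _ v => ?_⟩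
  -- the chart of `X` corresponding to the preferred chart of the toric manifold
  obtain ⟨I, hI⟩ := chart_mem_atlas (Fin n → ℂ) (A.toToric x)
  obtain ⟨a, rfl⟩ := A.exists_facet_eq I
  have hmem := mem_chart_source (Fin n → ℂ) (A.toToric x)
  rw [← hI] at hmem
  have ha : x ∈ (A.chart a).source := A.toToric_mem_chartSource.1 hmem
  have ha' : x ∈ (Φ a).source := by rwa [hA] at ha
  let P : (Fin n → ℂ) →L[ℝ] (Fin n → ℂ) :=
    ((A.permCLE a : (Fin n → ℂ) →L[ℂ] (Fin n → ℂ))).restrictScalars ℝ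
  have h1 : HasMFDerivAt (𝓡 (2 * n)) 𝓘(ℝ, Fin n → ℂ) (P ∘ (Φ a).toOpenPartialHomeomorph) x
      (P ∘L (Φ a).diff x) :=
    P.hasMFDerivAt.comp x ((Φ a).mdifferentiableAt ha').hasMFDerivAt
  have h2 : HasMFDerivAt (𝓡 (2 * n)) 𝓘(ℝ, Fin n → ℂ)
      (fun y => chartAt (Fin n → ℂ) (A.toToric x) (A.toToric y)) x (P ∘L (Φ a).diff x) := by
    refine h1.congr_of_eventuallyEq ?_
    filter_upwards [(A.chart a).open_source.mem_nhds ha] with y hy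
    rw [← hI, A.chart_toToric hy, hA]
    rfl
  have h3 := hasMFDerivAt_of_chartAt_comp
    (contMDiff_toToric Φ A hA).continuous.continuousAt h2
  intro df
  have hdf : ∀ u, df u = A.permCLE a ((Φ a).diff x u) := fun u =>
    congrArg (fun B : TangentSpace (𝓡 (2 * n)) x →L[ℝ] (Fin n → ℂ) => B u) h3.mfderiv
  rw [hdf, hdf, hJ a x ha', map_smul]

end

theorem exists_toricManifold (hX : IsTopologicalToricManifold n X) (hJ : J.IsInvariant) :
    ∃ (Δ : NonsingularCompleteFan n)
      (f : X ≃ₘ^∞⟮𝓡 (2 * n), 𝓘(ℝ, Fin n → ℂ)⟯ Δ.ToricManifold)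
      (ρ : CTorus n ≃ₘ^∞⟮𝓘(ℝ, Fin n → ℂ), 𝓘(ℝ, Fin n → ℂ)⟯ CTorus n),
      J.IsHolomorphicOn f Set.univ ∧
      (∀ g h : CTorus n, ρ (g * h) = ρ g * ρ h) ∧
      ∀ (g : CTorus n) (x : X), f (g • x) = ρ g • f x := by
  have := hX.compactSpace
  have := hX.t2Space
  obtain ⟨x₀, -, ho, hs⟩ := exists_orbit_subset_source hX
  choose Ψ hΨ hmem using fun x => exists_isAdapted hX hJ ho hs x
  obtain ⟨t, ht⟩ := isCompact_univ.elim_finite_subcover (fun x => (Ψ x).source)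
    (fun x => (Ψ x).open_source) fun x _ => Set.mem_iUnion.2 ⟨x, hmem x⟩
  let Φ : t → EquivariantChart n X := fun a => Ψ a
  have hΦ : ∀ a, (Φ a).IsAdapted J x₀ := fun a => hΨ a
  have hcover : ∀ x, ∃ a, x ∈ (Φ a).source := by
    intro x
    obtain ⟨y, hy⟩ := Set.mem_iUnion.1 (ht (Set.mem_univ x))
    obtain ⟨hyt, hxy⟩ := Set.mem_iUnion.1 hy
    exact ⟨⟨y, hyt⟩, hxy⟩
  let A := monomialAtlas Φ hX ho hs hΦ hcover
  have hA : ∀ a, A.chart a = (Φ a).toOpenPartialHomeomorph := fun _ => rfl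
  have hρ := (Φ A.base).torusHom_injective hX
  refine ⟨A.fan, ⟨Equiv.ofBijective _ A.toToric_bijective, contMDiff_toToric Φ A hA,
      contMDiff_toToric_symm Φ A hA⟩,
    ⟨Equiv.ofBijective _ (SmoothCharacter.torusHom_bijective hρ), contMDiff_torusHom _,
      contMDiff_torusHom_symm hρ⟩, ?_, ?_, ?_⟩
  · exact isHolomorphicOn_toToric Φ A hA fun a => (hΦ a).isJLinear
  · exact map_mul (torusHom (Φ A.base).weight)
  · intro g x
    obtain ⟨a, ha⟩ := hcover x
    refine A.toToric_of_mul (t := torusHom (Φ a).weight g) ha ((Φ a).smul_mem g x ha) (fun i => ?_)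
      (torusHom_eq_prod hX (hΦ A.base) (hΦ a) g)
    exact congrFun ((Φ a).apply_smul g ha) i

end EquivariantChart

end

theorem theorem1p2 (n : ℕ) (X : Type*) [TopologicalSpace X]
    [ChartedSpace (EuclideanSpace ℝ (Fin (2 * n))) X] [IsManifold (𝓡 (2 * n)) ∞ X]
    [MulAction (CTorus n) X] (hX : IsTopologicalToricManifold n X)
    (J : AlmostComplexStructure n X) (hJ : J.IsInvariant) :
    -- `J` is integrable
    J.IsIntegrable ∧
    -- the equivariant charts compatible with the omniorientation given by `J` are holomorphic
    (∀ φ : EquivariantChart n X, J.IsCompatible φ →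
      J.IsHolomorphicOn φ.toOpenPartialHomeomorph φ.source) ∧
    -- every equivariant chart becomes compatible after conjugating some of its coordinates
    (∀ φ : EquivariantChart n X, ∃ ψ : EquivariantChart n X, ψ.source = φ.source ∧
      J.IsCompatible ψ ∧
      ∀ i, (∀ x ∈ φ.source,
          ψ.toOpenPartialHomeomorph x i = φ.toOpenPartialHomeomorph x i) ∨
        (∀ x ∈ φ.source, ψ.toOpenPartialHomeomorph x i =
          (starRingEnd ℂ) (φ.toOpenPartialHomeomorph x i))) ∧
    -- `X` is weakly equivariantly biholomorphic to a toric manifold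
    ∃ (Δ : NonsingularCompleteFan n)
      (f : X ≃ₘ^∞⟮𝓡 (2 * n), 𝓘(ℝ, Fin n → ℂ)⟯ Δ.ToricManifold)
      (ρ : CTorus n ≃ₘ^∞⟮𝓘(ℝ, Fin n → ℂ), 𝓘(ℝ, Fin n → ℂ)⟯ CTorus n),
      J.IsHolomorphicOn f Set.univ ∧
      (∀ g h : CTorus n, ρ (g * h) = ρ g * ρ h) ∧
      ∀ (g : CTorus n) (x : X), f (g • x) = ρ g • f x := by
  refine ⟨fun x => ?_, fun φ hφ => ?_, fun φ => ?_, EquivariantChart.exists_toricManifold hX hJ⟩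
  · obtain ⟨φ, hx⟩ := hX.exists_chart x
    obtain ⟨ψ, hψ, hψJ, -⟩ := EquivariantChart.exists_isJLinear_conj φ hX hJ
    exact ⟨ψ.toOpenPartialHomeomorph, hψ ▸ hx, hψJ.isHolomorphicOn, ψ.smooth_symm⟩
  · exact (EquivariantChart.isJLinear_of_isCompatible hX hJ hφ).isHolomorphicOn
  · obtain ⟨ψ, hψ, hψJ, h⟩ := EquivariantChart.exists_isJLinear_conj φ hX hJ
    exact ⟨ψ, hψ, hψJ.isCompatible, h⟩
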